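/- Let $n\in\mathbb N$ and let $\mathbb H^n=\mathbb R^n\times\mathbb R^n\times\mathbb R$ be the Heisenberg group with group law $(x,u,t)(y,v,s)=(x+y,\,u+v,\,t+s+\tfrac12(u\cdot y-v\cdot x))$ and Haar measure $dx\,du\,dt$. For $\lambda\in\mathbb R\setminus\{0\}$ let $\pi_\lambda$ be the Schrödinger representation of $\mathbb H^n$ on $V=L^2(\mathbb R^n)$, $$\pi_\lambda(x,u,t)\varphi(\xi)=e^{i\lambda t}e^{i\lambda(x\cdot\xi+\frac12x\cdot u)}\varphi(\xi+u),$$ and for $f\in L^1(\mathbb H^n)$ put $\pi_\lambda(f)\varphi=\int_{\mathbb H^n}f(p)\,\pi_\lambda(p)\varphi\,dp$. Let $V^\omega$ be the space of analytic vectors of $\pi_\lambda$, that is, of those $\varphi\in V$ for which $p\mapsto\pi_\lambda(p)\varphi$ is a real analytic map from $\mathbb H^n$ to $V$. Convolution on $L^1(\mathbb H^n)$ is $(f*g)(p)=\int_{\mathbb H^n}f(pq^{-1})g(q)\,dq$. For $f\in L^1(\mathbb H^n)$ let $f^\lambda(x,u)=\int_{\mathbb R}f(x,u,t)e^{i\lambda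 t}\,dt$, and let $$\mathcal F_1f^\lambda(x,u)=(2\pi)^{-n/2}\int_{\mathbb R^n}f^\lambda(y,u)e^{-ix\cdot y}\,dy,\qquad \mathcal F_2f^\lambda(x,u)=(2\pi)^{-n/2}\int_{\mathbb R^n}f^\lambda(x,v)e^{-iu\cdot v}\,dv$$ be its partial Fourier transforms. Let $\mathcal B^\lambda$ be the set of all $f\in L^1(\mathbb H^n)$ for which there are $t>0$ and $C$ such that, for almost all $(x,u)\in\mathbb R^{2n}$, $$|\mathcal F_1f^\lambda(x,u)|\le C e^{-t\left(\frac1{|\lambda|}|x|^2+\frac{|\lambda|}4|u|^2\right)^{1/2}},\qquad |\mathcal F_2f^\lambda(x,u)|\le C e^{-t\left(\frac{|\lambda|}4|x|^2+\frac1{|\lambda|}|u|^2\right)^{1/2}}.$$ Then $\mathcal B^\lambda$ is an algebra under convolution (a complex linear subspace of $L^1(\mathbb H^n)$ closed under the associative and bilinear product $*$), and $$\pi_\lambda(\mathcal B^\lambda)V:=\{\pi_\lambda(f)\varphi : f\in\mathcal B^\lambda,\ \varphi\in V\}=V^\omega .$$ -/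

import Mathlib

open MeasureTheory

noncomputable section

namespace HeisenbergGroup

/-- Euclidean space `ℝⁿ`. -/
abbrev E (n : ℕ) := EuclideanSpace ℝ (Fin n)

/-- The Heisenberg group `ℍⁿ = ℝⁿ × ℝⁿ × ℝ` as a manifold, with its Haar measure `dx du dt`.
A point is written `(x, u, t)`. -/
abbrev H (n : ℕ) := E n × E n × ℝ

/-- The group law `(x,u,t)(y,v,s) = (x+y, u+v, t+s+(u·y - v·x)/2)`. -/
def mul {n : ℕ} (p q : H n) : H n :=
  (p.1 + q.1, p.2.1 + q.2.1,
    p.2.2 + q.2.2 + (1 / 2) * (inner ℝ p.2.1 q.1 - inner ℝ q.2.1 p.1))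

/-- The group inverse `(x,u,t)⁻¹ = (-x,-u,-t)`. -/
def inv {n : ℕ} (p : H n) : H n := (-p.1, -p.2.1, -p.2.2)

/-- `V = L²(ℝⁿ)`. -/
abbrev V (n : ℕ) := Lp ℂ 2 (volume : Measure (E n))

/-- `L¹(ℍⁿ)`. -/
abbrev L1 (n : ℕ) := Lp ℂ 1 (volume : Measure (H n))

/-- `(π_lam(x,u,t)φ)(ξ) = e^{i lam t} e^{i lam (x·ξ + x·u/2)} φ(ξ+u)`, for functions `φ`. -/
def schrodingerFun {n : ℕ} (lam : ℝ) (p : H n) (φ : E n → ℂ) (ξ : E n) : ℂ :=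
  Complex.exp (Complex.I * ((lam * p.2.2 : ℝ) : ℂ)) *
    Complex.exp (Complex.I *
      ((lam * (inner ℝ p.1 ξ + (1 / 2) * inner ℝ p.1 p.2.1) : ℝ) : ℂ)) *
    φ (ξ + p.2.1)

theorem memLp_schrodingerFun {n : ℕ} (lam : ℝ) (p : H n) (φ : V n) :
    MemLp (schrodingerFun lam p φ) 2 volume := by
  have h1 : MemLp (fun ξ => φ (ξ + p.2.1)) 2 volume :=
    (Lp.memLp φ).comp_measurePreserving (measurePreserving_add_right volume p.2.1)
  refine h1.of_le ?_ (Filter.Eventually.of_forall fun ξ => ?_)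
  · refine AEStronglyMeasurable.mul (Continuous.aestronglyMeasurable ?_) h1.1
    fun_prop
  · simp only [schrodingerFun, norm_mul, Complex.norm_exp_I_mul_ofReal, one_mul]
    exact le_rfl

/-- The Schrödinger representation `π_lam` of `ℍⁿ` on `L²(ℝⁿ)`. -/
def schrodinger {n : ℕ} (lam : ℝ) (p : H n) (φ : V n) : V n :=
  (memLp_schrodingerFun lam p φ).toLp

/-- The integrated representation `π_lam(f)φ = ∫ f(p) π_lam(p)φ dp`, `f ∈ L¹(ℍⁿ)`
(a Bochner integral in `L²(ℝⁿ)`). -/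
def schrodingerInt {n : ℕ} (lam : ℝ) (f : L1 n) (φ : V n) : V n :=
  ∫ p : H n, f p • schrodinger lam p φ

/-- The analytic vectors of `π_lam`: those `φ` whose orbit map `p ↦ π_lam(p)φ` is real analytic
from `ℍⁿ` to `L²(ℝⁿ)`. -/
def analyticVectors (n : ℕ) (lam : ℝ) : Set (V n) :=
  {φ | AnalyticOnNhd ℝ (fun p : H n => schrodinger lam p φ) Set.univ}

/-- `p ↦ p q⁻¹`, together with the second variable, preserves the measure. -/
theorem measurePreserving_mul_inv (n : ℕ) :
    MeasurePreserving (fun z : H n × H n => (mul z.1 (inv z.2), z.2))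
      (volume.prod volume) (volume.prod volume) := by
  have hm : Continuous (fun z : H n × H n => mul z.1 (inv z.2)) := by
    unfold mul inv; fun_prop
  have hfib : ∀ q : H n, MeasurePreserving (fun p : H n => mul p (inv q)) volume volume := by
    rintro ⟨y, v, s⟩
    refine MeasurePreserving.skew_product (f := fun x : E n => x + -y)
      (g := fun (x : E n) (w : E n × ℝ) =>
        (w.1 + -v, w.2 + -s + (1 / 2) * (inner ℝ w.1 (-y) - inner ℝ (-v) x)))
      (measurePreserving_add_right volume (-y)) ?_ (Filter.Eventually.of_forall fun x => ?_)
    · exact Continuous.measurable (by fun_prop)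
    · refine (MeasurePreserving.skew_product (f := fun u : E n => u + -v)
        (g := fun (u : E n) (t : ℝ) =>
          t + -s + (1 / 2) * (inner ℝ u (-y) - inner ℝ (-v) x))
        (measurePreserving_add_right volume (-v)) ?_
        (Filter.Eventually.of_forall fun u => ?_)).map_eq
      · exact Continuous.measurable (by fun_prop)
      · have := (measurePreserving_add_right (volume : Measure ℝ)
          (-s + (1 / 2) * (inner ℝ u (-y) - inner ℝ (-v) x))).map_eq
        simpa only [add_assoc] using this
  have h1 : MeasurePreserving (fun z : H n × H n => (z.1, mul z.2 (inv z.1)))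
      (volume.prod volume) (volume.prod volume) := by
    refine MeasurePreserving.skew_product (f := fun q : H n => q)
      (g := fun (q p : H n) => mul p (inv q)) (MeasurePreserving.id volume) ?_
      (Filter.Eventually.of_forall fun q => (hfib q).map_eq)
    exact (hm.comp continuous_swap).measurable
  exact (Measure.measurePreserving_swap.comp h1).comp Measure.measurePreserving_swap

theorem integrable_conv {n : ℕ} (f g : L1 n) :
    Integrable (fun p : H n => ∫ q : H n, f (mul p (inv q)) * g q) volume := by
  have h : Integrable (fun z : H n × H n => f z.1 * g z.2) (volume.prod volume) :=
    (L1.integrable_coeFn f).mul_prod (L1.integrable_coeFn g)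
  exact ((measurePreserving_mul_inv n).integrable_comp_of_integrable h).integral_prod_left

/-- Convolution on `L¹(ℍⁿ)`: `(f * g)(p) = ∫ f(p q⁻¹) g(q) dq`. -/
def conv {n : ℕ} (f g : L1 n) : L1 n := (integrable_conv f g).toL1 _

/-- `S ⊆ L¹(ℍⁿ)` is an algebra under convolution: a complex linear subspace closed under
convolution, on which convolution is associative and bilinear. -/
structure IsConvolutionAlgebra {n : ℕ} (S : Set (L1 n)) : Prop where
  zero_mem : (0 : L1 n) ∈ S
  add_mem : ∀ f ∈ S, ∀ g ∈ S, f + g ∈ S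
  smul_mem : ∀ (c : ℂ), ∀ f ∈ S, c • f ∈ S
  conv_mem : ∀ f ∈ S, ∀ g ∈ S, conv f g ∈ S
  conv_assoc : ∀ f ∈ S, ∀ g ∈ S, ∀ h ∈ S, conv (conv f g) h = conv f (conv g h)
  add_conv : ∀ f ∈ S, ∀ g ∈ S, ∀ h ∈ S, conv (f + g) h = conv f h + conv g h
  conv_add : ∀ f ∈ S, ∀ g ∈ S, ∀ h ∈ S, conv f (g + h) = conv f g + conv f h
  smul_conv : ∀ (c : ℂ), ∀ f ∈ S, ∀ g ∈ S, conv (c • f) g = c • conv f g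
  conv_smul : ∀ (c : ℂ), ∀ f ∈ S, ∀ g ∈ S, conv f (c • g) = c • conv f g

/-- `f^lam(x,u) = ∫ f(x,u,t) e^{i lam t} dt`. -/
def centralFourier {n : ℕ} (lam : ℝ) (f : H n → ℂ) (x u : E n) : ℂ :=
  ∫ t : ℝ, f (x, u, t) * Complex.exp (Complex.I * ((lam * t : ℝ) : ℂ))

/-- The partial Fourier transform in the first variable,
`(ℱ₁F)(x,u) = (2π)^{-n/2} ∫ F(y,u) e^{-i x·y} dy`. -/
def fourier1 {n : ℕ} (F : E n → E n → ℂ) (x u : E n) : ℂ :=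
  (((2 * Real.pi) ^ (-(n : ℝ) / 2) : ℝ) : ℂ) *
    ∫ y : E n, F y u * Complex.exp (-Complex.I * ((inner ℝ x y : ℝ) : ℂ))

/-- The partial Fourier transform in the second variable,
`(ℱ₂F)(x,u) = (2π)^{-n/2} ∫ F(x,v) e^{-i u·v} dv`. -/
def fourier2 {n : ℕ} (F : E n → E n → ℂ) (x u : E n) : ℂ :=
  (((2 * Real.pi) ^ (-(n : ℝ) / 2) : ℝ) : ℂ) *
    ∫ v : E n, F x v * Complex.exp (-Complex.I * ((inner ℝ u v : ℝ) : ℂ))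

/-- The space `𝓑^lam`. The elements of `L¹(ℍⁿ)` are classes of functions, so the
two pointwise estimates are required almost everywhere. -/
def B (n : ℕ) (lam : ℝ) : Set (L1 n) :=
  {f | ∃ t : ℝ, 0 < t ∧ ∃ C : ℝ,
    (∀ᵐ z : E n × E n, ‖fourier1 (centralFourier lam f) z.1 z.2‖ ≤
      C * Real.exp (-t * √((1 / |lam|) * ‖z.1‖ ^ 2 + (|lam| / 4) * ‖z.2‖ ^ 2))) ∧
    (∀ᵐ z : E n × E n, ‖fourier2 (centralFourier lam f) z.1 z.2‖ ≤
      C * Real.exp (-t * √((|lam| / 4) * ‖z.1‖ ^ 2 + (1 / |lam|) * ‖z.2‖ ^ 2)))}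

end HeisenbergGroup

end

/-! The operator `π(f)` has an integral kernel which is the partial Fourier transform `ℱ₁ f^lam` in
suitable coordinates, and its conjugate by the Fourier transform of `L²(ℝⁿ)` has the kernel given by
`ℱ₂ f^lam`, because the Fourier transform intertwines `π` with its composition with an automorphism
of `ℍⁿ`. The condition `f ∈ 𝓑` therefore says that both kernels decay exponentially. Convolution
of functions is composition of kernels, which preserves exponential decay, so `𝓑` is an algebra.

A vector is analytic if and only if it and its Fourier transform decay exponentially, since `π`
restricted to the coordinate subgroups acts by modulations and translations; this gives
`π(𝓑)V ⊆ V^ω`. Conversely, an analytic `ψ` is, up to a nonzero constant, `π(f)` applied to the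
Gaussian, where `f(x, u, t)` is the coherent state coefficient of `ψ` times a Gaussian in `t`; the
exponential decay of `ψ` and of its Fourier transform puts `f` into `𝓑`. -/

noncomputable section

namespace HeisenbergGroup

open Filter
open scoped ENNReal NNReal Topology ContDiff FourierTransform Real

/-! ### Exponential multipliers depend analytically on the exponent -/

section ExpMultiplier

theorem norm_cexp_sub_sum_le {z : ℂ} {s y : ℝ} (hs : 0 ≤ s) (hs1 : s ≤ 1) (hy : 0 ≤ y)
    (hz : ‖z‖ ≤ s * y) (k : ℕ) :
    ‖Complex.exp z - ∑ m ∈ Finset.range k, z ^ m / m.factorial‖ ≤ s ^ k * Real.exp y := by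
  have hasSum_exp (x : ℝ) : HasSum (fun m : ℕ => x ^ m / m.factorial) (Real.exp x) := by
    simpa [Real.exp_eq_exp_ℝ] using NormedSpace.expSeries_div_hasSum_exp (𝔸 := ℝ) x
  have tail_z := (hasSum_nat_add_iff' k).mpr (hasSum_exp ‖z‖)
  have tail_y := ((hasSum_nat_add_iff' k).mpr (hasSum_exp y)).mul_left (s ^ k)
  calc _ ≤ Real.exp ‖z‖ - ∑ m ∈ Finset.range k, ‖z‖ ^ m / m.factorial :=
        Complex.norm_exp_sub_sum_le_exp_norm_sub_sum z k
    _ ≤ s ^ k * (Real.exp y - ∑ m ∈ Finset.range k, y ^ m / m.factorial) := by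
        refine hasSum_le (fun m => ?_) tail_z tail_y
        rw [← mul_div_assoc]
        gcongr
        calc ‖z‖ ^ (m + k) ≤ (s * y) ^ (m + k) := by gcongr
          _ = s ^ (m + k) * y ^ (m + k) := mul_pow ..
          _ ≤ s ^ k * y ^ (m + k) :=
            mul_le_mul_of_nonneg_right (pow_le_pow_of_le_one hs hs1 (by omega)) (by positivity)
    _ ≤ s ^ k * Real.exp y := by
        gcongr
        exact sub_le_self _ (Finset.sum_nonneg fun _ _ => by positivity)

variable {Ω W G : Type*} [NormedAddCommGroup W] [NormedSpace ℝ W]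
  [NormedAddCommGroup G] [NormedSpace ℝ G] {L : Ω → W →L[ℝ] ℂ} {N : Ω → ℝ} {φ : Ω → ℂ} {r : ℝ}

/-- The homogeneous terms `(L w)ᵏ φ / k!` of the expansion of `w ↦ exp (L w) φ`, polarized. -/
def expMultiplierTerm (L : Ω → W →L[ℝ] ℂ) (φ : Ω → ℂ) (k : ℕ) :
    MultilinearMap ℝ (fun _ : Fin k => W) (Ω → ℂ) :=
  MultilinearMap.pi fun a => (φ a / k.factorial) •
    (MultilinearMap.mkPiAlgebra ℝ (Fin k) ℂ).compLinearMap fun _ => (L a : W →ₗ[ℝ] ℂ)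

theorem expMultiplierTerm_apply (L : Ω → W →L[ℝ] ℂ) (φ : Ω → ℂ) (k : ℕ) (m : Fin k → W) (a : Ω) :
    expMultiplierTerm L φ k m a = φ a / k.factorial * ∏ i, L a (m i) := rfl

theorem norm_expMultiplierTerm_le (hN : ∀ a, ‖L a‖ ≤ N a) (φ : Ω → ℂ) (hr : 0 < r) (k : ℕ)
    (m : Fin k → W) (a : Ω) :
    ‖expMultiplierTerm L φ k m a‖ ≤
      r⁻¹ ^ k * (∏ i, ‖m i‖) * ‖Real.exp (r * N a) * ‖φ a‖‖ := by
  have hN0 : 0 ≤ N a := (norm_nonneg _).trans (hN a)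
  have norm_prod_le : ‖∏ i, L a (m i)‖ ≤ N a ^ k * ∏ i, ‖m i‖ := by
    calc ‖∏ i, L a (m i)‖ ≤ ∏ i, (N a * ‖m i‖) := by
          rw [norm_prod]
          gcongr with i
          exact (L a).le_of_opNorm_le (hN a) (m i)
      _ = N a ^ k * ∏ i, ‖m i‖ := by simp [Finset.prod_mul_distrib]
  have pow_le_exp : N a ^ k / k.factorial ≤ r⁻¹ ^ k * Real.exp (r * N a) := by
    calc N a ^ k / k.factorial = r⁻¹ ^ k * ((r * N a) ^ k / k.factorial) := by
          rw [mul_pow, inv_pow]; field_simp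
      _ ≤ r⁻¹ ^ k * Real.exp (r * N a) := by
          gcongr; exact Real.pow_div_factorial_le_exp _ (by positivity) k
  rw [expMultiplierTerm_apply, norm_mul, norm_div, Complex.norm_natCast, norm_mul, norm_norm,
    Real.norm_of_nonneg (Real.exp_pos _).le]
  calc ‖φ a‖ / k.factorial * ‖∏ i, L a (m i)‖
      ≤ ‖φ a‖ / k.factorial * (N a ^ k * ∏ i, ‖m i‖) := by gcongr
    _ = N a ^ k / k.factorial * ((∏ i, ‖m i‖) * ‖φ a‖) := by ring
    _ ≤ r⁻¹ ^ k * Real.exp (r * N a) * ((∏ i, ‖m i‖) * ‖φ a‖) := by gcongr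
    _ = _ := by ring

variable [MeasurableSpace Ω] {μ : Measure Ω} {p : ℝ≥0∞}

/-- A multilinear map into functions on `Ω` with values in `Lᵖ`, dominated pointwise by a fixed
`g ∈ Lᵖ`, as a continuous multilinear map into `Lᵖ`. -/
def multilinearToLp [Fact (1 ≤ p)] {k : ℕ} (T : MultilinearMap ℝ (fun _ : Fin k => W) (Ω → G))
    (hT : ∀ m, AEStronglyMeasurable (T m) μ) {g : Ω → ℝ} (hg : MemLp g p μ) {C : ℝ}
    (hTg : ∀ m a, ‖T m a‖ ≤ C * (∏ i, ‖m i‖) * ‖g a‖) :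
    ContinuousMultilinearMap ℝ (fun _ : Fin k => W) (Lp G p μ) :=
  have memLp m : MemLp (T m) p μ := hg.of_le_mul (hT m) (.of_forall (hTg m))
  MultilinearMap.mkContinuous
    { toFun := fun m => (memLp m).toLp
      map_update_add' := fun m i x y =>
        (MemLp.toLp_congr _ ((memLp _).add (memLp _)) (.of_eq (T.map_update_add m i x y))).trans
          (MemLp.toLp_add _ _)
      map_update_smul' := fun m i c x =>
        (MemLp.toLp_congr _ ((memLp _).const_smul c) (.of_eq (T.map_update_smul m i c x))).trans
          (MemLp.toLp_const_smul c _) }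
    (C * ‖hg.toLp‖) fun m => by
      rw [mul_right_comm]
      refine Lp.norm_le_mul_norm_of_ae_le_mul ?_
      filter_upwards [(memLp m).coeFn_toLp, hg.coeFn_toLp] with a ha hga
      simpa only [MultilinearMap.coe_mk, ha, hga] using hTg m a

theorem multilinearToLp_coeFn [Fact (1 ≤ p)] {k : ℕ}
    (T : MultilinearMap ℝ (fun _ : Fin k => W) (Ω → G))
    (hT : ∀ m, AEStronglyMeasurable (T m) μ) {g : Ω → ℝ} (hg : MemLp g p μ) {C : ℝ}
    (hTg : ∀ m a, ‖T m a‖ ≤ C * (∏ i, ‖m i‖) * ‖g a‖) (m : Fin k → W) :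
    multilinearToLp T hT hg hTg m =ᵐ[μ] T m :=
  (hg.of_le_mul (hT m) (.of_forall (hTg m))).coeFn_toLp

theorem norm_multilinearToLp_le [Fact (1 ≤ p)] {k : ℕ}
    (T : MultilinearMap ℝ (fun _ : Fin k => W) (Ω → G))
    (hT : ∀ m, AEStronglyMeasurable (T m) μ) {g : Ω → ℝ} (hg : MemLp g p μ) {C : ℝ} (hC : 0 ≤ C)
    (hTg : ∀ m a, ‖T m a‖ ≤ C * (∏ i, ‖m i‖) * ‖g a‖) :
    ‖multilinearToLp T hT hg hTg‖ ≤ C * ‖hg.toLp‖ := by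
  unfold multilinearToLp
  exact MultilinearMap.mkContinuous_norm_le _ (by positivity) _

theorem aestronglyMeasurable_expMultiplierTerm (hL : ∀ w, AEStronglyMeasurable (L · w) μ)
    (hφ : AEStronglyMeasurable φ μ) (k : ℕ) (m : Fin k → W) :
    AEStronglyMeasurable (expMultiplierTerm L φ k m) μ :=
  (hφ.mul_const (k.factorial : ℂ)⁻¹).mul
    (Finset.aestronglyMeasurable_fun_prod Finset.univ fun i _ => hL (m i))

/-- The Taylor series at `0` of `w ↦ exp (L w) φ` as a map into `Lᵖ`. -/
def expMultiplierSeries [Fact (1 ≤ p)] (hL : ∀ w, AEStronglyMeasurable (L · w) μ)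
    (hN : ∀ a, ‖L a‖ ≤ N a) (hφ : AEStronglyMeasurable φ μ) (hr : 0 < r)
    (hφr : MemLp (fun a => Real.exp (r * N a) * ‖φ a‖) p μ) :
    FormalMultilinearSeries ℝ W (Lp ℂ p μ) := fun k =>
  multilinearToLp (expMultiplierTerm L φ k) (aestronglyMeasurable_expMultiplierTerm hL hφ k) hφr
    (norm_expMultiplierTerm_le hN φ hr k)

variable [Fact (1 ≤ p)] {J : W → Lp ℂ p μ}

theorem le_radius_expMultiplierSeries (hL : ∀ w, AEStronglyMeasurable (L · w) μ)
    (hN : ∀ a, ‖L a‖ ≤ N a) (hφ : AEStronglyMeasurable φ μ) (hr : 0 < r)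
    (hφr : MemLp (fun a => Real.exp (r * N a) * ‖φ a‖) p μ) :
    ENNReal.ofReal r ≤ (expMultiplierSeries hL hN hφ hr hφr).radius := by
  refine FormalMultilinearSeries.le_radius_of_bound _ (r := r.toNNReal) ‖hφr.toLp‖ fun k => ?_
  rw [Real.coe_toNNReal _ hr.le]
  calc ‖expMultiplierSeries hL hN hφ hr hφr k‖ * r ^ k ≤ r⁻¹ ^ k * ‖hφr.toLp‖ * r ^ k := by
        gcongr; exact norm_multilinearToLp_le _ _ _ (by positivity) _
    _ = ‖hφr.toLp‖ := by rw [inv_pow]; field_simp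

theorem norm_sub_sum_expMultiplierSeries_le (hL : ∀ w, AEStronglyMeasurable (L · w) μ)
    (hN : ∀ a, ‖L a‖ ≤ N a) (hφ : AEStronglyMeasurable φ μ) (hr : 0 < r)
    (hφr : MemLp (fun a => Real.exp (r * N a) * ‖φ a‖) p μ) {w : W} (hw : ‖w‖ < r)
    {ψ : Lp ℂ p μ} (hψ : ψ =ᵐ[μ] fun a => Complex.exp (L a w) * φ a) (k : ℕ) :
    ‖ψ - ∑ j ∈ Finset.range k, expMultiplierSeries hL hN hφ hr hφr j fun _ => w‖ ≤
      (‖w‖ / r) ^ k * ‖hφr.toLp‖ := by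
  have terms : ∀ᵐ a ∂μ, ∀ j, (expMultiplierSeries hL hN hφ hr hφr j fun _ => w) a =
      expMultiplierTerm L φ j (fun _ => w) a :=
    ae_all_iff.2 fun j => multilinearToLp_coeFn _ _ _ _ _
  refine Lp.norm_le_mul_norm_of_ae_le_mul ?_
  filter_upwards [hψ, Lp.coeFn_sub ψ (∑ j ∈ Finset.range k, expMultiplierSeries hL hN hφ hr hφr j
      fun _ => w), Lp.coeFn_fun_finsetSum (Finset.range k)
      (fun j => expMultiplierSeries hL hN hφ hr hφr j fun _ => w), terms, hφr.coeFn_toLp]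
    with a ha hsub hsum hterms hg
  rw [hsub, Pi.sub_apply, ha, hsum, hg]
  have factor : Complex.exp (L a w) * φ a - ∑ j ∈ Finset.range k, expMultiplierTerm L φ j
      (fun _ => w) a =
      (Complex.exp (L a w) - ∑ j ∈ Finset.range k, L a w ^ j / j.factorial) * φ a := by
    rw [sub_mul, Finset.sum_mul]
    congr! 2 with j
    rw [expMultiplierTerm_apply, Fin.prod_const]
    ring
  have hLw : ‖L a w‖ ≤ ‖w‖ / r * (r * N a) := by
    rw [div_mul_eq_mul_div, le_div_iff₀ hr]
    linarith [mul_le_mul_of_nonneg_right ((L a).le_of_opNorm_le (hN a) w) hr.le]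
  have hN0 : 0 ≤ N a := (norm_nonneg _).trans (hN a)
  simp only [hterms]
  rw [factor, norm_mul, norm_mul, norm_norm, Real.norm_of_nonneg (Real.exp_pos _).le, ← mul_assoc]
  gcongr
  exact norm_cexp_sub_sum_le (by positivity) ((div_le_one hr).2 hw.le) (by positivity) hLw k

theorem analyticAt_expMultiplier (hL : ∀ w, AEStronglyMeasurable (L · w) μ)
    (hN : ∀ a, ‖L a‖ ≤ N a) (hφ : AEStronglyMeasurable φ μ) (hr : 0 < r)
    (hφr : MemLp (fun a => Real.exp (r * N a) * ‖φ a‖) p μ)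
    (hJ : ∀ w, ‖w‖ < r → J w =ᵐ[μ] fun a => Complex.exp (L a w) * φ a) : AnalyticAt ℝ J 0 := by
  have hradius := le_radius_expMultiplierSeries hL hN hφ hr hφr
  refine ⟨expMultiplierSeries hL hN hφ hr hφr, ENNReal.ofReal r, hradius, by simpa using hr,
    fun {w} hw => ?_⟩
  have hwr : ‖w‖ < r := by simpa [Metric.eball_ofReal] using hw
  rw [zero_add, (FormalMultilinearSeries.summable _ (Metric.eball_subset_eball hradius hw))
    |>.hasSum_iff_tendsto_nat, tendsto_iff_norm_sub_tendsto_zero]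
  refine squeeze_zero (g := fun k => (‖w‖ / r) ^ k * ‖hφr.toLp‖) (fun _ => norm_nonneg _)
    (fun k => ?_) ?_
  · rw [norm_sub_rev]
    exact norm_sub_sum_expMultiplierSeries_le hL hN hφ hr hφr hwr (hJ w hwr) k
  · simpa using (tendsto_pow_atTop_nhds_zero_of_lt_one (by positivity)
      ((div_lt_one hr).2 hwr)).mul_const ‖hφr.toLp‖

end ExpMultiplier

/-! ### The Fourier transform on `L¹ ∩ L²` -/

section Fourier

variable {F : Type*} [NormedAddCommGroup F] [InnerProductSpace ℝ F] [FiniteDimensional ℝ F]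
  [MeasurableSpace F] [BorelSpace F] {f g : F → ℂ}

theorem continuous_fourier (hf : Integrable f) : Continuous (𝓕 f) :=
  VectorFourier.fourierIntegral_continuous Real.continuous_fourierChar continuous_inner hf

theorem continuous_fourierInv (hf : Integrable f) : Continuous (𝓕⁻ f) := by
  rw [Real.fourierInv_eq_fourier_comp_neg]
  exact continuous_fourier hf.comp_neg

theorem fourier_comp_neg (f : F → ℂ) (w : F) : 𝓕 (fun x => f (-x)) w = 𝓕 f (-w) :=
  Real.fourier_comp_linearIsometry (LinearIsometryEquiv.neg ℝ (E := F)) f w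

theorem integral_fourier_mul (hf : Integrable f) (hg : Integrable g) :
    ∫ ξ, 𝓕 f ξ * g ξ = ∫ x, f x * 𝓕 g x := by
  simpa using! VectorFourier.integral_bilin_fourierIntegral_eq_flip (ContinuousLinearMap.mul ℂ ℂ)
    (L := innerₗ F) Real.continuous_fourierChar continuous_inner hf hg

theorem integral_fourierInv_mul (hf : Integrable f) (hg : Integrable g) :
    ∫ ξ, 𝓕⁻ f ξ * g ξ = ∫ x, f x * 𝓕⁻ g x := by
  have h := integral_fourier_mul hf.comp_neg hg
  simp only [fourier_comp_neg] at h
  simp only [Real.fourierInv_eq_fourier_neg]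
  rw [h, ← integral_neg_eq_self]
  simp

theorem ae_eq_of_integral_schwartz_mul_eq (hf : LocallyIntegrable f) (hg : LocallyIntegrable g)
    (h : ∀ s : SchwartzMap F ℂ, ∫ x, s x * f x = ∫ x, s x * g x) : f =ᵐ[volume] g := by
  refine ae_eq_of_integral_contDiff_smul_eq hf hg fun χ hχ hχc => ?_
  have hsupp : HasCompactSupport (Complex.ofRealCLM ∘ χ) := hχc.comp_left rfl
  exact h (hsupp.toSchwartzMap (Complex.ofRealCLM.contDiff.comp hχ))

theorem fourier_coeFn (f : Lp (α := F) ℂ 2) (hf : Integrable f) :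
    (𝓕 f : Lp (α := F) ℂ 2) =ᵐ[volume] 𝓕 (f : F → ℂ) := by
  refine ae_eq_of_integral_schwartz_mul_eq ((Lp.memLp _).locallyIntegrable (by norm_num))
    (continuous_fourier hf).locallyIntegrable fun s => ?_
  have h := congrArg (· s) (Lp.fourier_toTemperedDistribution_eq f)
  simp only [TemperedDistribution.fourier_apply, Lp.toTemperedDistribution_apply, smul_eq_mul,
    SchwartzMap.fourier_coe] at h
  exact h.symm.trans (integral_fourier_mul s.integrable hf)

theorem fourierInv_coeFn (f : Lp (α := F) ℂ 2) (hf : Integrable f) :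
    (𝓕⁻ f : Lp (α := F) ℂ 2) =ᵐ[volume] 𝓕⁻ (f : F → ℂ) := by
  refine ae_eq_of_integral_schwartz_mul_eq ((Lp.memLp _).locallyIntegrable (by norm_num))
    (continuous_fourierInv hf).locallyIntegrable fun s => ?_
  have h := congrArg (· s) (Lp.fourierInv_toTemperedDistribution_eq f)
  simp only [TemperedDistribution.fourierInv_apply, Lp.toTemperedDistribution_apply, smul_eq_mul,
    SchwartzMap.fourierInv_coe] at h
  exact h.symm.trans (integral_fourierInv_mul s.integrable hf)

theorem norm_fourier_le (f : F → ℂ) (w : F) : ‖𝓕 f w‖ ≤ ∫ v, ‖f v‖ :=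
  VectorFourier.norm_fourierIntegral_le_integral_norm _ _ _ _ _

theorem exists_lipschitzWith_fourier (hf : Integrable f)
    (hf' : Integrable fun v => ‖v‖ * ‖f v‖) : ∃ K, LipschitzWith K (𝓕 f) := by
  have hK : 0 ≤ ∫ v, ‖VectorFourier.fourierSMulRight (innerSL ℝ) f v‖ := by positivity
  refine ⟨⟨_, hK⟩, lipschitzWith_of_nnnorm_fderiv_le (𝕜 := ℝ)
    (Real.differentiable_fourier hf hf') fun w => NNReal.coe_le_coe.1 ?_⟩
  rw [Real.fderiv_fourier hf hf']
  exact VectorFourier.norm_fourierIntegral_le_integral_norm _ _ _ _ _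

end Fourier

/-! ### Exponential decay -/

section Decay

theorem one_add_pow_mul_exp_neg_le {t y : ℝ} (ht : 0 < t) (hy : 0 ≤ y) (k : ℕ) :
    (1 + y) ^ k * Real.exp (-t * y) ≤ t⁻¹ ^ k * k.factorial * Real.exp t := by
  have hpow : (1 + y) ^ k = t⁻¹ ^ k * (t * (1 + y)) ^ k := by
    rw [← mul_pow, inv_mul_cancel_left₀ ht.ne']
  have hexp : (t * (1 + y)) ^ k ≤ k.factorial * Real.exp (t * (1 + y)) := by
    rw [← div_le_iff₀' (by positivity)]
    exact Real.pow_div_factorial_le_exp _ (by positivity) k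
  calc (1 + y) ^ k * Real.exp (-t * y)
      ≤ t⁻¹ ^ k * (k.factorial * Real.exp (t * (1 + y))) * Real.exp (-t * y) := by
        rw [hpow]; gcongr
    _ = t⁻¹ ^ k * k.factorial * Real.exp (t * (1 + y) + -t * y) := by rw [Real.exp_add]; ring
    _ = _ := by ring_nf

section Haar

variable {F : Type*} [NormedAddCommGroup F] [NormedSpace ℝ F] [FiniteDimensional ℝ F]
  [MeasurableSpace F] [BorelSpace F] {μ : Measure F} [μ.IsAddHaarMeasure]

theorem integrable_exp_neg_mul_norm {t : ℝ} (ht : 0 < t) :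
    Integrable (fun x : F => Real.exp (-t * ‖x‖)) μ := by
  set d := Module.finrank ℝ F
  have h : Integrable (fun x : F => (1 + ‖x‖) ^ (-((d + 1 : ℕ) : ℝ))) μ :=
    integrable_one_add_norm (by push_cast; exact lt_add_one _)
  refine (h.const_mul (t⁻¹ ^ (d + 1) * (d + 1).factorial * Real.exp t)).mono'
    (Continuous.aestronglyMeasurable (by fun_prop)) (.of_forall fun x => ?_)
  rw [Real.norm_of_nonneg (Real.exp_pos _).le, Real.rpow_neg (by positivity), Real.rpow_natCast,
    ← div_eq_mul_inv, le_div_iff₀' (by positivity)]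
  exact one_add_pow_mul_exp_neg_le ht (norm_nonneg x) (d + 1)

theorem memLp_two_exp_neg_mul_norm {t : ℝ} (ht : 0 < t) :
    MemLp (fun x : F => Real.exp (-t * ‖x‖)) 2 μ := by
  rw [memLp_two_iff_integrable_sq (Continuous.aestronglyMeasurable (by fun_prop))]
  convert integrable_exp_neg_mul_norm (μ := μ) (mul_pos two_pos ht) using 2 with x
  rw [← Real.exp_nat_mul]
  push_cast
  ring_nf

end Haar

/-- Exponential decay: `|φ(ξ)| ≤ C e^{-t|ξ|}` everywhere, for some `t > 0`. -/
def ExpDecay {F : Type*} [Norm F] (φ : F → ℂ) : Prop :=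
  ∃ t : ℝ, 0 < t ∧ ∃ C : ℝ, ∀ ξ, ‖φ ξ‖ ≤ C * Real.exp (-t * ‖ξ‖)

/-- Exponential decay in the mean: `e^{r|ξ|} φ` is square integrable for some `r > 0`. -/
def ExpWeighted {F : Type*} [Norm F] [MeasureSpace F] (φ : F → ℂ) : Prop :=
  ∃ r : ℝ, 0 < r ∧ MemLp (fun ξ => Real.exp (r * ‖ξ‖) * ‖φ ξ‖) 2 volume

theorem ExpWeighted.congr {F : Type*} [Norm F] [MeasureSpace F] {φ ψ : F → ℂ} (h : ExpWeighted φ)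
    (e : φ =ᵐ[volume] ψ) : ExpWeighted ψ := by
  obtain ⟨r, hr, h⟩ := h
  refine ⟨r, hr, (memLp_congr_ae ?_).1 h⟩
  filter_upwards [e] with x hx
  rw [hx]

theorem ExpDecay.comp_neg {F : Type*} [SeminormedAddCommGroup F] {φ : F → ℂ}
    (h : ExpDecay φ) : ExpDecay fun ξ => φ (-ξ) := by
  obtain ⟨t, ht, C, hC⟩ := h
  exact ⟨t, ht, C, fun ξ => by simpa using hC (-ξ)⟩

theorem half_norm_le_of_mem_ball {F : Type*} [SeminormedAddCommGroup F] {φ : F → ℂ}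
    {K : ℝ≥0} (hK : 0 < K) (hφ : LipschitzWith K φ)
    {ξ η : F} (hη : η ∈ Metric.ball ξ (‖φ ξ‖ / (2 * K))) : ‖φ ξ‖ / 2 ≤ ‖φ η‖ := by
  have hlip : ‖φ ξ - φ η‖ ≤ ‖φ ξ‖ / 2 := by
    calc ‖φ ξ - φ η‖ ≤ K * ‖η - ξ‖ := by rw [norm_sub_rev]; exact hφ.norm_sub_le η ξ
      _ ≤ K * (‖φ ξ‖ / (2 * K)) := by gcongr; exact (mem_ball_iff_norm.1 hη).le
      _ = ‖φ ξ‖ / 2 := by field_simp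
  linarith [norm_sub_norm_le (φ ξ) (φ η)]

variable {F : Type*} [NormedAddCommGroup F] [InnerProductSpace ℝ F] [FiniteDimensional ℝ F]
  [MeasurableSpace F] [BorelSpace F] {φ : F → ℂ}

theorem ExpDecay.integrable (h : ExpDecay φ) (hm : AEStronglyMeasurable φ volume) :
    Integrable φ := by
  obtain ⟨t, ht, C, hC⟩ := h
  exact ((integrable_exp_neg_mul_norm ht).const_mul C).mono' hm (.of_forall hC)

theorem ExpDecay.memLp (h : ExpDecay φ) (hm : AEStronglyMeasurable φ volume) :
    MemLp φ 2 volume := by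
  obtain ⟨t, ht, C, hC⟩ := h
  refine (memLp_two_exp_neg_mul_norm ht).of_le_mul (c := C) hm (.of_forall fun ξ => ?_)
  simpa only [Real.norm_of_nonneg (Real.exp_pos _).le] using hC ξ

theorem ExpWeighted.exists_integrable_exp_mul (h : ExpWeighted φ) :
    ∃ r : ℝ, 0 < r ∧ Integrable fun ξ => Real.exp (r * ‖ξ‖) * ‖φ ξ‖ := by
  obtain ⟨r, hr, h⟩ := h
  refine ⟨r / 2, half_pos hr, ?_⟩
  have hprod : Integrable fun ξ => Real.exp (-(r / 2) * ‖ξ‖) * (Real.exp (r * ‖ξ‖) * ‖φ ξ‖) :=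
    (memLp_two_exp_neg_mul_norm (half_pos hr)).integrable_mul h
  refine hprod.congr (.of_forall fun ξ => ?_)
  beta_reduce
  rw [← mul_assoc, ← Real.exp_add]
  ring_nf

theorem ExpWeighted.integrable (h : ExpWeighted φ) (hm : AEStronglyMeasurable φ volume) :
    Integrable φ := by
  obtain ⟨r, hr, h⟩ := h.exists_integrable_exp_mul
  exact h.mono' hm (.of_forall fun ξ =>
    le_mul_of_one_le_left (norm_nonneg _) (Real.one_le_exp (by positivity)))

theorem ExpWeighted.integrable_norm_mul (h : ExpWeighted φ)
    (hm : AEStronglyMeasurable φ volume) : Integrable fun ξ => ‖ξ‖ * ‖φ ξ‖ := by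
  obtain ⟨r, hr, h⟩ := h.exists_integrable_exp_mul
  refine (h.const_mul r⁻¹).mono' (by fun_prop) (.of_forall fun ξ => ?_)
  have hξ : ‖ξ‖ ≤ r⁻¹ * Real.exp (r * ‖ξ‖) := by
    rw [inv_mul_eq_div, le_div_iff₀' hr]
    linarith [Real.add_one_le_exp (r * ‖ξ‖)]
  rw [norm_mul, norm_norm, norm_norm, ← mul_assoc]
  gcongr

/-- The norm of `φ` is at least `‖φ ξ‖ / 2` on the ball of radius `‖φ ξ‖ / (2 * K)` around `ξ`. -/
theorem norm_pow_mul_measureReal_ball_le {K : ℝ≥0} (hK : 0 < K) (hφ : LipschitzWith K φ)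
    (hbd : ∀ ξ, ‖φ ξ‖ ≤ K) (ξ : F) :
    ‖φ ξ‖ ^ (Module.finrank ℝ F + 2) * volume.real (Metric.ball (0 : F) 1) ≤
      4 * (2 * K) ^ Module.finrank ℝ F * ∫ η in Metric.ball ξ 1, ‖φ η‖ ^ 2 := by
  set d := Module.finrank ℝ F
  obtain h0 | h0 := (norm_nonneg (φ ξ)).eq_or_lt
  · rw [← h0, zero_pow (by omega), zero_mul]
    positivity
  set ρ := ‖φ ξ‖ / (2 * K) with hρ
  have hρ0 : 0 < ρ := by positivity
  have hρ1 : ρ ≤ 1 := by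
    rw [hρ, div_le_one (by positivity)]
    linarith [hbd ξ, K.coe_nonneg]
  have hint : IntegrableOn (fun η => ‖φ η‖ ^ 2) (Metric.ball ξ 1) :=
    ((hφ.continuous.norm.pow 2).continuousOn.integrableOn_compact
      (isCompact_closedBall ξ 1)).mono_set Metric.ball_subset_closedBall
  have lower : (‖φ ξ‖ / 2) ^ 2 * (ρ ^ d * volume.real (Metric.ball (0 : F) 1)) ≤
      ∫ η in Metric.ball ξ 1, ‖φ η‖ ^ 2 := by
    calc _ = ∫ _ in Metric.ball ξ ρ, (‖φ ξ‖ / 2) ^ 2 := by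
          rw [setIntegral_const, smul_eq_mul, mul_comm, Measure.real, Measure.real,
            Measure.addHaar_ball_of_pos _ _ hρ0, ENNReal.toReal_mul,
            ENNReal.toReal_ofReal (by positivity)]
      _ ≤ ∫ η in Metric.ball ξ ρ, ‖φ η‖ ^ 2 :=
          setIntegral_mono_on (integrableOn_const measure_ball_lt_top.ne)
            (hint.mono_set (Metric.ball_subset_ball hρ1)) measurableSet_ball fun η hη => by
              gcongr; exact half_norm_le_of_mem_ball hK hφ hη
      _ ≤ _ := setIntegral_mono_set hint (.of_forall fun _ => by positivity)
          (Metric.ball_subset_ball hρ1).eventuallyLE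
  calc _ = 4 * (2 * K) ^ d *
        ((‖φ ξ‖ / 2) ^ 2 * (ρ ^ d * volume.real (Metric.ball (0 : F) 1))) := by
        rw [hρ, div_pow, div_pow]; field_simp; ring
    _ ≤ _ := by gcongr

theorem setIntegral_ball_norm_sq_le {r : ℝ} (hr : 0 < r)
    (h : MemLp (fun ξ => Real.exp (r * ‖ξ‖) * ‖φ ξ‖) 2 volume)
    (hφ : Continuous φ) (ξ : F) :
    ∫ η in Metric.ball ξ 1, ‖φ η‖ ^ 2 ≤
      Real.exp (2 * r) * Real.exp (-(2 * r) * ‖ξ‖) *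
        ∫ η, (Real.exp (r * ‖η‖) * ‖φ η‖) ^ 2 := by
  have hint := (memLp_two_iff_integrable_sq h.1).1 h
  rw [← integral_const_mul]
  refine (setIntegral_mono_on ?_ (hint.const_mul _).integrableOn measurableSet_ball
    fun η hη => ?_).trans
    (setIntegral_le_integral (hint.const_mul _) (.of_forall fun _ => by positivity))
  · exact ((hφ.norm.pow 2).continuousOn.integrableOn_compact
      (isCompact_closedBall ξ 1)).mono_set Metric.ball_subset_closedBall
  · have hη1 : ‖ξ‖ - 1 ≤ ‖η‖ := by
      linarith [norm_sub_norm_le ξ η, norm_sub_rev ξ η, mem_ball_iff_norm.1 hη]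
    rw [mul_pow, ← Real.exp_nat_mul, ← mul_assoc, ← Real.exp_add, ← Real.exp_add]
    refine le_mul_of_one_le_left (by positivity) (Real.one_le_exp ?_)
    push_cast
    nlinarith

theorem ExpWeighted.expDecay (h : ExpWeighted φ) {K : ℝ≥0} (hφ : LipschitzWith K φ) {M : ℝ}
    (hM : ∀ ξ, ‖φ ξ‖ ≤ M) : ExpDecay φ := by
  obtain ⟨r, hr, h⟩ := h
  set d := Module.finrank ℝ F
  set L : ℝ≥0 := K + M.toNNReal + 1
  have hL : LipschitzWith L φ := hφ.weaken (le_self_add.trans le_self_add)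
  have hLbd ξ : ‖φ ξ‖ ≤ L := by
    have : (L : ℝ) = K + max M 0 + 1 := by simp [L]
    linarith [hM ξ, le_max_left M 0, K.coe_nonneg]
  have hb : 0 < volume.real (Metric.ball (0 : F) 1) :=
    ENNReal.toReal_pos (Metric.measure_ball_pos _ _ one_pos).ne' measure_ball_lt_top.ne
  set A := 4 * (2 * L) ^ d * (Real.exp (2 * r) * ∫ η, (Real.exp (r * ‖η‖) * ‖φ η‖) ^ 2) /
    volume.real (Metric.ball (0 : F) 1)
  have hpow ξ : ‖φ ξ‖ ^ (d + 2) ≤ A * Real.exp (-(2 * r) * ‖ξ‖) := by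
    rw [div_mul_eq_mul_div, le_div_iff₀ hb]
    calc _ ≤ 4 * (2 * L) ^ d * ∫ η in Metric.ball ξ 1, ‖φ η‖ ^ 2 :=
          norm_pow_mul_measureReal_ball_le (by positivity) hL hLbd ξ
      _ ≤ 4 * (2 * L) ^ d * (Real.exp (2 * r) * Real.exp (-(2 * r) * ‖ξ‖) *
          ∫ η, (Real.exp (r * ‖η‖) * ‖φ η‖) ^ 2) := by
          gcongr; exact setIntegral_ball_norm_sq_le hr h hφ.continuous ξ
      _ = _ := by ring
  have hA : 0 ≤ A := by positivity
  refine ⟨2 * r / (d + 2 : ℕ), by positivity, A ^ ((d + 2 : ℕ) : ℝ)⁻¹, fun ξ => ?_⟩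
  have hroot := (Real.le_rpow_inv_iff_of_pos (norm_nonneg (φ ξ))
    (mul_nonneg hA (Real.exp_pos (-(2 * r) * ‖ξ‖)).le) (z := (d + 2 : ℕ)) (by positivity)).2
    (by rw [Real.rpow_natCast]; exact hpow ξ)
  refine hroot.trans_eq ?_
  rw [Real.mul_rpow hA (Real.exp_pos _).le, ← Real.exp_mul]
  ring_nf

theorem norm_le_of_norm_inner_le {α : Type*} [MeasurableSpace α] {μ : Measure α} (ψ : Lp ℂ 2 μ)
    {w : α → ℝ} (hw : MemLp w 2 μ) (hw0 : ∀ x, 0 ≤ w x)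
    (h : ∀ g : Lp ℂ 2 μ, ‖inner ℂ g ψ‖ ≤ ∫ x, ‖g x‖ * w x ∂μ) : ∀ᵐ x ∂μ, ‖ψ x‖ ≤ w x := by
  set A : Set α := {x | w x < ‖ψ x‖}
  have hA : NullMeasurableSet A μ :=
    nullMeasurableSet_lt hw.1.aemeasurable (Lp.memLp ψ).1.norm.aemeasurable
  have hg : MemLp (A.indicator ψ) 2 μ := (Lp.memLp ψ).of_le ((Lp.memLp ψ).1.indicator₀ hA)
    (.of_forall fun _ => norm_indicator_le_norm_self _ _)
  have hsq : IntegrableOn (fun x => ‖ψ x‖ ^ 2) A μ :=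
    ((memLp_two_iff_integrable_sq_norm (Lp.memLp ψ).1).1 (Lp.memLp ψ)).integrableOn
  have hmul : IntegrableOn (fun x => ‖ψ x‖ * w x) A μ :=
    ((Lp.memLp ψ).norm.integrable_mul hw).integrableOn
  have hle : ∫ x in A, ‖ψ x‖ ^ 2 ∂μ ≤ ∫ x in A, ‖ψ x‖ * w x ∂μ := by
    have hinner : inner ℂ hg.toLp ψ = ((∫ x in A, ‖ψ x‖ ^ 2 ∂μ : ℝ) : ℂ) := by
      rw [L2.inner_def, ← integral_complex_ofReal, ← integral_indicator₀ hA]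
      refine integral_congr_ae ?_
      filter_upwards [hg.coeFn_toLp] with x hx
      rw [hx]
      by_cases hxA : x ∈ A <;> simp [hxA]
    have hint : ∫ x, ‖(hg.toLp : Lp ℂ 2 μ) x‖ * w x ∂μ = ∫ x in A, ‖ψ x‖ * w x ∂μ := by
      rw [← integral_indicator₀ hA]
      refine integral_congr_ae ?_
      filter_upwards [hg.coeFn_toLp] with x hx
      rw [hx]
      by_cases hxA : x ∈ A <;> simp [hxA]
    have := h hg.toLp
    rw [hinner, hint, Complex.norm_real] at this
    exact (le_abs_self _).trans this
  have hpos x (hx : x ∈ A) : 0 < ‖ψ x‖ ^ 2 - ‖ψ x‖ * w x := by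
    have hx' : w x < ‖ψ x‖ := hx
    nlinarith [hw0 x]
  have hnonneg : 0 ≤ᵐ[μ.restrict A] fun x => ‖ψ x‖ ^ 2 - ‖ψ x‖ * w x :=
    (ae_restrict_mem₀ hA).mono fun x hx => (hpos x hx).le
  have hzero := (setIntegral_eq_zero_iff_of_nonneg_ae hnonneg (hsq.sub hmul)).1
    (((integral_sub hsq hmul).trans_le (sub_nonpos.2 hle)).antisymm
      (integral_nonneg_of_ae hnonneg))
  filter_upwards [(ae_restrict_iff'₀ hA).1 hzero] with x hx
  by_contra hxA
  exact (hpos x (not_le.1 hxA)).ne' (hx (not_le.1 hxA))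

end Decay

/-! ### The Schrödinger representation -/

section Representation

variable {n : ℕ} (lam : ℝ)

theorem schrodinger_coeFn (p : H n) (φ : V n) :
    schrodinger lam p φ =ᵐ[volume] schrodingerFun lam p φ :=
  (memLp_schrodingerFun lam p φ).coeFn_toLp

theorem ae_comp_add_right {P : E n → Prop} (h : ∀ᵐ ξ, P ξ) (u : E n) : ∀ᵐ ξ, P (ξ + u) :=
  (measurePreserving_add_right volume u).quasiMeasurePreserving.ae h

theorem schrodingerFun_congr (p : H n) {φ ψ : E n → ℂ} (h : φ =ᵐ[volume] ψ) :
    schrodingerFun lam p φ =ᵐ[volume] schrodingerFun lam p ψ := by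
  filter_upwards [ae_comp_add_right h p.2.1] with ξ hξ
  simp only [schrodingerFun, hξ]

theorem norm_schrodingerFun (p : H n) (φ : E n → ℂ) (ξ : E n) :
    ‖schrodingerFun lam p φ ξ‖ = ‖φ (ξ + p.2.1)‖ := by
  simp only [schrodingerFun, norm_mul, Complex.norm_exp_I_mul_ofReal, one_mul]

/-- The operator `π_lam(p)` as a linear isometry of `L²(ℝⁿ)`. -/
def schrodingerₗᵢ (p : H n) : V n →ₗᵢ[ℂ] V n where
  toFun := schrodinger lam p
  map_add' φ ψ := by
    refine Lp.ext ?_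
    filter_upwards [schrodinger_coeFn lam p (φ + ψ), schrodinger_coeFn lam p φ,
      schrodinger_coeFn lam p ψ, Lp.coeFn_add (schrodinger lam p φ) (schrodinger lam p ψ),
      schrodingerFun_congr lam p (Lp.coeFn_add φ ψ)] with ξ h1 h2 h3 h4 h5
    rw [h1, h4, h5, Pi.add_apply, h2, h3]
    simp only [schrodingerFun, Pi.add_apply, mul_add]
  map_smul' c φ := by
    refine Lp.ext ?_
    filter_upwards [schrodinger_coeFn lam p (c • φ), schrodinger_coeFn lam p φ,
      Lp.coeFn_smul c (schrodinger lam p φ),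
      schrodingerFun_congr lam p (Lp.coeFn_smul c φ)] with ξ h1 h2 h4 h5
    rw [h1, RingHom.id_apply, h4, h5, Pi.smul_apply, h2]
    simp only [schrodingerFun, Pi.smul_apply, smul_eq_mul]
    ring
  norm_map' φ := by
    change ‖schrodinger lam p φ‖ = ‖φ‖
    rw [schrodinger, Lp.norm_toLp, Lp.norm_def]
    congr 1
    rw [eLpNorm_congr_norm_ae (g := fun ξ => φ (ξ + p.2.1))
      (.of_forall fun ξ => norm_schrodingerFun lam p φ ξ)]
    exact eLpNorm_comp_measurePreserving (Lp.memLp φ).1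
      (measurePreserving_add_right volume p.2.1)

@[simp] theorem schrodingerₗᵢ_apply (p : H n) (φ : V n) :
    schrodingerₗᵢ lam p φ = schrodinger lam p φ := rfl

theorem norm_schrodinger (p : H n) (φ : V n) : ‖schrodinger lam p φ‖ = ‖φ‖ :=
  (schrodingerₗᵢ lam p).norm_map φ

theorem schrodingerFun_mul (p q : H n) (φ : E n → ℂ) :
    schrodingerFun lam p (schrodingerFun lam q φ) = schrodingerFun lam (mul p q) φ := by
  obtain ⟨x, u, t⟩ := p
  obtain ⟨y, v, s⟩ := q
  funext ξ
  simp only [schrodingerFun, mul]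
  rw [add_assoc ξ u v]
  simp only [← mul_assoc, ← Complex.exp_add, ← mul_add, ← Complex.ofReal_add]
  congr 4
  simp only [inner_add_left, inner_add_right]
  rw [real_inner_comm u y, real_inner_comm x v]
  ring

theorem schrodinger_mul (p q : H n) (φ : V n) :
    schrodinger lam p (schrodinger lam q φ) = schrodinger lam (mul p q) φ := by
  refine Lp.ext ?_
  filter_upwards [schrodinger_coeFn lam p (schrodinger lam q φ), schrodinger_coeFn lam (mul p q) φ,
    schrodingerFun_congr lam p (schrodinger_coeFn lam q φ)] with ξ h1 h2 h3
  rw [h1, h2, h3, schrodingerFun_mul]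

theorem schrodinger_central (s : ℝ) (φ : V n) :
    schrodinger lam (0, 0, s) φ = Complex.exp (Complex.I * ((lam * s : ℝ) : ℂ)) • φ := by
  refine Lp.ext ?_
  filter_upwards [schrodinger_coeFn lam (0, 0, s) φ,
    Lp.coeFn_smul (Complex.exp (Complex.I * ((lam * s : ℝ) : ℂ))) φ] with ξ h1 h2
  rw [h1, h2]
  simp [schrodingerFun]

/-- The automorphism `α` of `ℍⁿ` with `𝓕 π_lam(p) = π_lam(α(p)) 𝓕`, where `𝓕` is Mathlib's Fourier
transform, with kernel `e^{-2πi x·ξ}`. -/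
def fourierAut (p : H n) : H n :=
  ((2 * π / lam) • p.2.1, -((lam / (2 * π)) • p.1), p.2.2)

variable {lam}

theorem fourierAut_mul (hlam : lam ≠ 0) (p q : H n) :
    fourierAut lam (mul p q) = mul (fourierAut lam p) (fourierAut lam q) := by
  have : (2 * π / lam) * (lam / (2 * π)) = 1 := by
    have := Real.pi_ne_zero
    field_simp
  refine Prod.ext ?_ (Prod.ext ?_ ?_)
  · simp [fourierAut, mul]
  · simp [fourierAut, mul, add_comm]
  · simp only [fourierAut, mul, inner_neg_left, real_inner_smul_left, real_inner_smul_right]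
    rw [real_inner_comm q.2.1 p.1, real_inner_comm p.2.1 q.1]
    linear_combination (-(1 / 2) * (inner ℝ p.2.1 q.1 - inner ℝ q.2.1 p.1) : ℝ) * this

theorem fourier_schrodingerFun (hlam : lam ≠ 0) (p : H n) (φ : E n → ℂ) :
    𝓕 (schrodingerFun lam p φ) = schrodingerFun lam (fourierAut lam p) (𝓕 φ) := by
  obtain ⟨x, u, t⟩ := p
  funext w
  have hpi := Real.pi_ne_zero
  simp only [schrodingerFun, fourierAut]
  rw [Real.fourier_eq', Real.fourier_eq', ← integral_const_mul,
    ← integral_sub_right_eq_self _ u]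
  refine integral_congr_ae (.of_forall fun ξ => ?_)
  simp only [smul_eq_mul, schrodingerFun, sub_add_cancel, ← mul_assoc]
  congr 1
  simp only [← Complex.exp_add]
  congr 1
  simp only [inner_sub_left, inner_sub_right, inner_add_right, inner_neg_right,
    real_inner_smul_left, real_inner_smul_right]
  rw [real_inner_comm x u, real_inner_comm x ξ]
  have hl : (lam : ℂ) ≠ 0 := by exact_mod_cast hlam
  have hp : (π : ℂ) ≠ 0 := by exact_mod_cast hpi
  push_cast
  field_simp
  ring

theorem integrable_schrodinger {φ : V n} (hφ : Integrable φ) (p : H n) :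
    Integrable (schrodinger lam p φ) :=
  ((hφ.comp_add_right p.2.1).norm.mono' (memLp_schrodingerFun lam p φ).1
    (.of_forall fun ξ => (norm_schrodingerFun lam p φ ξ).le)).congr
      (schrodinger_coeFn lam p φ).symm

theorem fourier_schrodinger (hlam : lam ≠ 0) (p : H n) (φ : V n) :
    (𝓕 (schrodinger lam p φ) : V n) = schrodinger lam (fourierAut lam p) (𝓕 φ) := by
  refine (SchwartzMap.denseRange_toLpCLM (E := E n) (F := ℂ) (p := 2) (μ := volume)
    ENNReal.ofNat_ne_top).induction_on (p := fun φ : V n =>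
      (𝓕 (schrodinger lam p φ) : V n) = schrodinger lam (fourierAut lam p) (𝓕 φ)) φ ?_ fun s => ?_
  · exact isClosed_eq
      ((Lp.fourierTransformₗᵢ (E n) ℂ).continuous.comp (schrodingerₗᵢ lam p).continuous)
      ((schrodingerₗᵢ lam (fourierAut lam p)).continuous.comp
        (Lp.fourierTransformₗᵢ (E n) ℂ).continuous)
  set f : V n := s.toLp 2
  change (𝓕 (schrodinger lam p f) : V n) = schrodinger lam (fourierAut lam p) (𝓕 f)
  have hfs : f =ᵐ[volume] s := s.coeFn_toLp 2
  have hf : Integrable f := (integrable_congr hfs).2 s.integrable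
  have hfourier : 𝓕 (schrodinger lam p f : E n → ℂ) =
      schrodingerFun lam (fourierAut lam p) (𝓕 (f : E n → ℂ)) := by
    rw [← fourier_schrodingerFun hlam]
    exact funext fun w => Real.fourier_congr_ae (schrodinger_coeFn lam p f) w
  refine Lp.ext ((fourier_coeFn _ (integrable_schrodinger hf p)).trans ?_)
  rw [hfourier]
  exact (schrodingerFun_congr lam _ (fourier_coeFn f hf)).symm.trans
    (schrodinger_coeFn lam _ _).symm

theorem continuous_schrodinger_translation (φ : V n) :
    Continuous fun u : E n => schrodinger lam (0, u, 0) φ := by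
  have h := Continuous.compMeasurePreservingLp (X := E n) (Y := E n) (μ := volume) (ν := volume)
    (p := 2) (E := ℂ) (Z := E n)
    (g := fun u => (⟨fun ξ => ξ + u, by fun_prop⟩ : C(E n, E n))) (f := fun _ => φ)
    continuous_const (ContinuousMap.continuous_of_continuous_uncurry _ (by
      simp only [Function.uncurry_def]; exact continuous_snd.add continuous_fst))
    (fun u => measurePreserving_add_right volume u) (by norm_num)
  refine h.congr fun u => Lp.ext ?_
  filter_upwards [schrodinger_coeFn lam (0, u, 0) φ,
    Lp.coeFn_compMeasurePreserving φ (measurePreserving_add_right volume u)] with ξ h1 h2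
  rw [h1]
  refine h2.trans ?_
  simp [schrodingerFun]

theorem fourierAut_fst (x : E n) :
    fourierAut lam (x, 0, 0) = (0, -((lam / (2 * π)) • x), 0) := by
  simp [fourierAut]

theorem continuous_schrodinger_modulation (hlam : lam ≠ 0) (φ : V n) :
    Continuous fun x : E n => schrodinger lam (x, 0, 0) φ := by
  have h : ∀ x : E n, schrodinger lam (x, 0, 0) φ = (Lp.fourierTransformₗᵢ (E n) ℂ).symm
      (schrodinger lam (0, -((lam / (2 * π)) • x), 0) (𝓕 φ)) := fun x => by
    rw [← fourierAut_fst, ← fourier_schrodinger hlam]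
    exact ((Lp.fourierTransformₗᵢ (E n) ℂ).symm_apply_apply _).symm
  simp only [h]
  refine (Lp.fourierTransformₗᵢ (E n) ℂ).symm.continuous.comp ?_
  exact (continuous_schrodinger_translation (𝓕 φ)).comp
    (f := fun x : E n => -((lam / (2 * π)) • x)) (by fun_prop)

theorem schrodinger_eq_comp (p : H n) (φ : V n) : schrodinger lam p φ =
    Complex.exp (Complex.I * ((lam * (p.2.2 + 1 / 2 * inner ℝ p.2.1 p.1) : ℝ) : ℂ)) •
      schrodinger lam (p.1, 0, 0) (schrodinger lam (0, p.2.1, 0) φ) := by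
  rw [← schrodinger_central, schrodinger_mul, schrodinger_mul]
  congr 1
  simp [mul]

theorem continuous_schrodinger (hlam : lam ≠ 0) (φ : V n) :
    Continuous fun p : H n => schrodinger lam p φ := by
  have hmod : Continuous fun z : E n × V n => schrodinger lam (z.1, 0, 0) z.2 :=
    continuous_prod_of_continuous_lipschitzWith' _ 1
      (fun x => (schrodingerₗᵢ lam (x, 0, 0)).lipschitz)
      (continuous_schrodinger_modulation hlam)
  rw [funext fun p : H n => schrodinger_eq_comp p φ]
  have htrans : Continuous fun p : H n => schrodinger lam (0, p.2.1, 0) φ :=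
    (continuous_schrodinger_translation φ).comp (f := fun p : H n => p.2.1) (by fun_prop)
  have hscalar : Continuous fun p : H n =>
      Complex.exp (Complex.I * ((lam * (p.2.2 + 1 / 2 * inner ℝ p.2.1 p.1) : ℝ) : ℂ)) := by
    fun_prop
  exact hscalar.smul (hmod.comp (f := fun p : H n => (p.1, schrodinger lam (0, p.2.1, 0) φ))
    (continuous_fst.prodMk htrans))

theorem integrable_smul_schrodinger (hlam : lam ≠ 0) {f : H n → ℂ} (hf : Integrable f)
    (φ : V n) : Integrable fun p => f p • schrodinger lam p φ := by
  refine (hf.norm.mul_const ‖φ‖).mono'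
    (hf.1.smul (continuous_schrodinger hlam φ).aestronglyMeasurable)
    (.of_forall fun p => ?_)
  rw [norm_smul, norm_schrodinger]

/-- The integrated representation as a continuous bilinear map. -/
def schrodingerIntCLM (hlam : lam ≠ 0) : L1 n →L[ℂ] V n →L[ℂ] V n :=
  LinearMap.mkContinuous₂
    (LinearMap.mk₂ ℂ (fun f φ => schrodingerInt lam f φ)
      (fun f g φ => by
        simp only [schrodingerInt]
        rw [← integral_add (integrable_smul_schrodinger hlam (L1.integrable_coeFn f) φ)
          (integrable_smul_schrodinger hlam (L1.integrable_coeFn g) φ)]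
        refine integral_congr_ae ?_
        filter_upwards [Lp.coeFn_add f g] with p hp
        rw [hp, Pi.add_apply, add_smul])
      (fun c f φ => by
        simp only [schrodingerInt]
        rw [← integral_smul]
        refine integral_congr_ae ?_
        filter_upwards [Lp.coeFn_smul c f] with p hp
        rw [hp, Pi.smul_apply, smul_assoc])
      (fun f φ ψ => by
        simp only [schrodingerInt]
        rw [← integral_add (integrable_smul_schrodinger hlam (L1.integrable_coeFn f) φ)
          (integrable_smul_schrodinger hlam (L1.integrable_coeFn f) ψ)]
        refine integral_congr_ae (.of_forall fun p => ?_)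
        simp only [← schrodingerₗᵢ_apply, map_add, smul_add])
      (fun c f φ => by
        simp only [schrodingerInt]
        rw [← integral_smul]
        refine integral_congr_ae (.of_forall fun p => ?_)
        simp only [← schrodingerₗᵢ_apply, map_smul]
        rw [smul_comm])) 1 (fun f φ => by
      simp only [LinearMap.mk₂_apply, one_mul, schrodingerInt]
      refine (norm_integral_le_integral_norm _).trans ?_
      simp only [norm_smul, norm_schrodinger]
      rw [integral_mul_const, L1.norm_eq_integral_norm])

@[simp] theorem schrodingerIntCLM_apply (hlam : lam ≠ 0) (f : L1 n) (φ : V n) :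
    schrodingerIntCLM hlam f φ = schrodingerInt lam f φ := rfl

theorem schrodingerInt_toL1 {f : H n → ℂ} (hf : Integrable f) (φ : V n) :
    schrodingerInt lam (hf.toL1 f) φ = ∫ p, f p • schrodinger lam p φ := by
  refine integral_congr_ae ?_
  filter_upwards [hf.coeFn_toL1] with p hp
  rw [hp]

end Representation

/-! ### Measure preserving maps on `ℍⁿ` -/

section Measure

variable {n : ℕ}

theorem measurePreserving_prodMap_smul {c d : ℝ} (h : c * d = -1) :
    MeasurePreserving (Prod.map (fun x : E n => c • x) fun x : E n => d • x) := by
  have hc : c ≠ 0 := left_ne_zero_of_mul (h ▸ neg_ne_zero.2 one_ne_zero)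
  have hd : d ≠ 0 := right_ne_zero_of_mul (h ▸ neg_ne_zero.2 one_ne_zero)
  refine ⟨by fun_prop, ?_⟩
  have hmap := Measure.map_prod_map (f := fun x : E n => c • x) (g := fun x : E n => d • x)
    volume volume (by fun_prop) (by fun_prop)
  rw [Measure.volume_eq_prod, ← hmap, Measure.map_addHaar_smul _ hc, Measure.map_addHaar_smul _ hd,
    Measure.prod_smul_left, Measure.prod_smul_right, smul_smul, ← ENNReal.ofReal_mul (abs_nonneg _),
    ← abs_mul, ← mul_inv, ← mul_pow, h]
  simp [abs_inv, abs_pow]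

theorem measurePreserving_assoc {A : E n × E n → E n × E n} (hA : MeasurePreserving A) :
    MeasurePreserving fun p : H n => ((A (p.1, p.2.1)).1, (A (p.1, p.2.1)).2, p.2.2) := by
  have h1 : MeasurePreserving (MeasurableEquiv.prodAssoc : (E n × E n) × ℝ ≃ᵐ H n) :=
    volume_preserving_prodAssoc
  exact (h1.comp (hA.prod (MeasurePreserving.id (volume : Measure ℝ)))).comp
    (h1.symm MeasurableEquiv.prodAssoc)

/-- Exchange of the first two variables. -/
def swapVar : H n ≃ᵐ H n :=
  Homeomorph.toMeasurableEquiv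
    { toFun := fun p => (p.2.1, p.1, p.2.2)
      invFun := fun p => (p.2.1, p.1, p.2.2)
      left_inv := fun _ => rfl
      right_inv := fun _ => rfl
      continuous_toFun := by fun_prop
      continuous_invFun := by fun_prop }

theorem measurePreserving_swapVar : MeasurePreserving (swapVar : H n ≃ᵐ H n) :=
  measurePreserving_assoc (A := Prod.swap) Measure.measurePreserving_swap

theorem ae_iterated {P : H n → Prop} (h : ∀ᵐ p, P p) : ∀ᵐ u, ∀ᵐ x, ∀ᵐ t, P (x, u, t) := by
  have h1 : ∀ᵐ p : H n, P (swapVar p) :=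
    measurePreserving_swapVar.quasiMeasurePreserving.ae h
  have h2 := Measure.ae_ae_of_ae_prod (show ∀ᵐ p ∂(volume.prod volume), P (swapVar p) from h1)
  filter_upwards [h2] with u hu
  exact Measure.ae_ae_of_ae_prod (show ∀ᵐ p ∂(volume.prod volume), P (swapVar (u, p)) from hu)

theorem ae_integrable_slice {F : H n → ℂ} (hF : Integrable F) :
    ∀ᵐ u, Integrable fun w : E n × ℝ => F (w.1, u, w.2) := by
  have h1 : Integrable (F ∘ swapVar) :=
    (measurePreserving_swapVar.integrable_comp_emb swapVar.measurableEmbedding).2 hF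
  exact Integrable.prod_right_ae (show Integrable (F ∘ swapVar) (volume.prod volume) from h1)

theorem integral_iterated {F : H n → ℂ} (hF : Integrable F) :
    ∫ p, F p = ∫ u, ∫ x, ∫ t, F (x, u, t) := by
  have h1 : Integrable (F ∘ swapVar) :=
    (measurePreserving_swapVar.integrable_comp_emb swapVar.measurableEmbedding).2 hF
  rw [← measurePreserving_swapVar.integral_comp' F]
  rw [show (∫ p : H n, F (swapVar p)) = ∫ p, (F ∘ swapVar) p ∂(volume.prod volume) from rfl,
    integral_prod _ h1]
  refine integral_congr_ae ?_
  filter_upwards [ae_integrable_slice hF] with u hu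
  exact integral_prod (fun w : E n × ℝ => F (w.1, u, w.2)) hu

variable {lam : ℝ}

theorem measurePreserving_fourierAut (hlam : lam ≠ 0) :
    MeasurePreserving (fourierAut lam : H n → H n) := by
  have h1 : 2 * π / lam * -(lam / (2 * π)) = -1 := by
    have := Real.pi_ne_zero
    field_simp
  have h2 : MeasurePreserving (fun z : E n × E n => z.swap) := Measure.measurePreserving_swap
  have h := measurePreserving_assoc ((measurePreserving_prodMap_smul (n := n) h1).comp h2)
  convert h using 2 with p
  simp [fourierAut]

theorem continuous_fourierAut : Continuous (fourierAut lam : H n → H n) := by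
  unfold fourierAut; fun_prop

theorem fourierAut_fourierAut (hlam : lam ≠ 0) (p : H n) :
    fourierAut lam (fourierAut lam p) = (-p.1, -p.2.1, p.2.2) := by
  have h1 : 2 * π / lam * (lam / (2 * π)) = 1 := by
    have := Real.pi_ne_zero
    field_simp
  have h2 : lam / (2 * π) * (2 * π / lam) = 1 := by rw [mul_comm, h1]
  simp [fourierAut, smul_smul, h1, h2]

theorem fourierAut_four (hlam : lam ≠ 0) (p : H n) :
    fourierAut lam (fourierAut lam (fourierAut lam (fourierAut lam p))) = p := by
  rw [fourierAut_fourierAut hlam, fourierAut_fourierAut hlam]; simp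

theorem measurableEmbedding_fourierAut (hlam : lam ≠ 0) :
    MeasurableEmbedding (fourierAut lam : H n → H n) := by
  refine continuous_fourierAut.measurableEmbedding fun p q h => ?_
  rw [← fourierAut_four hlam p, h, fourierAut_four hlam]

theorem integral_comp_fourierAut {F : Type*} [NormedAddCommGroup F] [NormedSpace ℝ F]
    (hlam : lam ≠ 0) (f : H n → F) : ∫ p, f (fourierAut lam p) = ∫ p, f p :=
  (measurePreserving_fourierAut hlam).integral_comp (measurableEmbedding_fourierAut hlam) f

end Measure

/-! ### Exponential decay with respect to a weight -/

section AEExpDecay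

variable {n : ℕ}

/-- Exponential decay almost everywhere along the weight `w`: `‖F‖ ≤ C e^{-t w}` for some
`t > 0`. -/
def AEExpDecay {α : Type*} [MeasureSpace α] (w : α → ℝ) (F : α → ℂ) : Prop :=
  ∃ t : ℝ, 0 < t ∧ ∃ C : ℝ, ∀ᵐ z, ‖F z‖ ≤ C * Real.exp (-t * w z)

variable {α : Type*} [MeasureSpace α] {w w' : α → ℝ} {F G : α → ℂ}

theorem mul_exp_neg_mul_le {a b A M y : ℝ} (hb : b ≤ a) (hA : A ≤ M) (hM : 0 ≤ M) (hy : 0 ≤ y) :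
    A * Real.exp (-a * y) ≤ M * Real.exp (-b * y) := by
  gcongr

theorem AEExpDecay.exists_common (hw : ∀ z, 0 ≤ w z) (hw' : ∀ z, 0 ≤ w' z)
    (hF : AEExpDecay w F) (hG : AEExpDecay w' G) : ∃ t : ℝ, 0 < t ∧ ∃ C : ℝ,
      (∀ᵐ z, ‖F z‖ ≤ C * Real.exp (-t * w z)) ∧ ∀ᵐ z, ‖G z‖ ≤ C * Real.exp (-t * w' z) := by
  obtain ⟨t, ht, C, hC⟩ := hF
  obtain ⟨s, hs, D, hD⟩ := hG
  have hM : 0 ≤ max |C| |D| := (abs_nonneg C).trans (le_max_left _ _)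
  refine ⟨min t s, lt_min ht hs, max |C| |D|, hC.mono fun z hz => hz.trans ?_,
    hD.mono fun z hz => hz.trans ?_⟩
  · exact mul_exp_neg_mul_le (min_le_left _ _) ((le_abs_self C).trans (le_max_left _ _)) hM (hw z)
  · exact mul_exp_neg_mul_le (min_le_right _ _) ((le_abs_self D).trans (le_max_right _ _)) hM
      (hw' z)

theorem AEExpDecay.congr (h : AEExpDecay w F) (e : F =ᵐ[volume] G) : AEExpDecay w G := by
  obtain ⟨t, ht, C, hC⟩ := h
  refine ⟨t, ht, C, ?_⟩
  filter_upwards [hC, e] with z hz hFG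
  rwa [← hFG]

theorem AEExpDecay.add (hw : ∀ z, 0 ≤ w z) (hF : AEExpDecay w F) (hG : AEExpDecay w G) :
    AEExpDecay w (F + G) := by
  obtain ⟨t, ht, C, hC, hD⟩ := hF.exists_common hw hw hG
  refine ⟨t, ht, C + C, ?_⟩
  filter_upwards [hC, hD] with z h1 h2
  rw [add_mul]
  exact (norm_add_le _ _).trans (add_le_add h1 h2)

theorem AEExpDecay.comp_of_le {β : Type*} [MeasureSpace β] {v : β → ℝ} {k : ℝ} {T : β → α}
    (h : AEExpDecay w F) (hT : Measure.QuasiMeasurePreserving T) (hk : 0 < k)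
    (hw : ∀ z, k * v z ≤ w (T z)) : AEExpDecay v (F ∘ T) := by
  obtain ⟨t, ht, C, hC⟩ := h
  refine ⟨t * k, by positivity, |C|, ?_⟩
  filter_upwards [hT.ae hC] with z hz
  calc _ ≤ C * Real.exp (-t * w (T z)) := hz
    _ ≤ |C| * Real.exp (-t * (k * v z)) := by
      gcongr ?_ * Real.exp ?_
      · exact le_abs_self C
      · nlinarith [hw z]
    _ = _ := by ring_nf

theorem AEExpDecay.of_le {k : ℝ} (h : AEExpDecay w F) (hk : 0 < k) (hw : ∀ z, k * w' z ≤ w z) :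
    AEExpDecay w' F :=
  h.comp_of_le (Measure.QuasiMeasurePreserving.id volume) hk hw

theorem AEExpDecay.const_mul (h : AEExpDecay w F) (c : ℂ) : AEExpDecay w fun z => c * F z := by
  obtain ⟨t, ht, C, hC⟩ := h
  refine ⟨t, ht, ‖c‖ * C, hC.mono fun z hz => ?_⟩
  rw [norm_mul, mul_assoc]
  gcongr

theorem aeExpDecay_const_mul_iff {c : ℂ} (hc : c ≠ 0) :
    AEExpDecay w (fun z => c * F z) ↔ AEExpDecay w F :=
  ⟨fun h => by simpa only [inv_mul_cancel_left₀ hc] using h.const_mul c⁻¹, fun h => h.const_mul c⟩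

theorem aeExpDecay_sqrt_iff {X Y : Type*} [SeminormedAddCommGroup X] [SeminormedAddCommGroup Y]
    [MeasureSpace (X × Y)] {F : X × Y → ℂ} {a b : ℝ} (ha : 0 < a) (hb : 0 < b) :
    AEExpDecay (fun z => √(a * ‖z.1‖ ^ 2 + b * ‖z.2‖ ^ 2)) F ↔
      AEExpDecay (fun z => ‖z.1‖ + ‖z.2‖) F := by
  have hM : 0 < max √a √b := lt_max_of_lt_left (by positivity)
  have hm : 0 < min √a √b := lt_min (by positivity) (by positivity)
  refine ⟨fun h => h.of_le (half_pos hm) fun z => ?_, fun h => h.of_le (inv_pos.2 hM) fun z => ?_⟩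
  · have h1 : √a * ‖z.1‖ ≤ √(a * ‖z.1‖ ^ 2 + b * ‖z.2‖ ^ 2) :=
      Real.le_sqrt_of_sq_le (by rw [mul_pow, Real.sq_sqrt ha.le]; nlinarith [sq_nonneg ‖z.2‖])
    have h2 : √b * ‖z.2‖ ≤ √(a * ‖z.1‖ ^ 2 + b * ‖z.2‖ ^ 2) :=
      Real.le_sqrt_of_sq_le (by rw [mul_pow, Real.sq_sqrt hb.le]; nlinarith [sq_nonneg ‖z.1‖])
    have h3 : min √a √b * ‖z.1‖ ≤ √a * ‖z.1‖ := by gcongr; exact min_le_left _ _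
    have h4 : min √a √b * ‖z.2‖ ≤ √b * ‖z.2‖ := by gcongr; exact min_le_right _ _
    linarith
  · rw [inv_mul_le_iff₀ hM]
    calc _ ≤ √a * ‖z.1‖ + √b * ‖z.2‖ := by
          refine Real.sqrt_le_iff.2 ⟨by positivity, ?_⟩
          rw [add_sq, mul_pow, mul_pow, Real.sq_sqrt ha.le, Real.sq_sqrt hb.le]
          have : 0 ≤ 2 * (√a * ‖z.1‖) * (√b * ‖z.2‖) := by positivity
          linarith
      _ ≤ max √a √b * ‖z.1‖ + max √a √b * ‖z.2‖ := by
        gcongr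
        exacts [le_max_left _ _, le_max_right _ _]
      _ = _ := (mul_add _ _ _).symm

theorem quasiMeasurePreserving_prodMap_smul {c d : ℝ} (hc : c ≠ 0) (hd : d ≠ 0) :
    Measure.QuasiMeasurePreserving (Prod.map (fun x : E n => c • x) fun x : E n => d • x) := by
  refine ⟨by fun_prop, ?_⟩
  rw [Measure.volume_eq_prod, ← Measure.map_prod_map _ _ (by fun_prop) (by fun_prop)]
  exact (Measure.quasiMeasurePreserving_smul volume hc).absolutelyContinuous.prod
    (Measure.quasiMeasurePreserving_smul volume hd).absolutelyContinuous

theorem AEExpDecay.comp_smul {F : E n × E n → ℂ} (h : AEExpDecay (fun z => ‖z.1‖ + ‖z.2‖) F)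
    {c d : ℝ} (hc : c ≠ 0) (hd : d ≠ 0) :
    AEExpDecay (fun z => ‖z.1‖ + ‖z.2‖) fun z : E n × E n => F (c • z.1, d • z.2) := by
  refine h.comp_of_le (quasiMeasurePreserving_prodMap_smul hc hd)
    (lt_min (abs_pos.2 hc) (abs_pos.2 hd)) fun z => ?_
  simp only [norm_smul, Real.norm_eq_abs, mul_add]
  gcongr
  exacts [min_le_left _ _, min_le_right _ _]

theorem aeExpDecay_comp_smul_iff {F : E n × E n → ℂ} {c d : ℝ} (hc : c ≠ 0) (hd : d ≠ 0) :
    AEExpDecay (fun z => ‖z.1‖ + ‖z.2‖) (fun z : E n × E n => F (c • z.1, d • z.2)) ↔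
      AEExpDecay (fun z => ‖z.1‖ + ‖z.2‖) F := by
  refine ⟨fun h => ?_, fun h => h.comp_smul hc hd⟩
  simpa only [smul_inv_smul₀ hc, smul_inv_smul₀ hd] using
    h.comp_smul (inv_ne_zero hc) (inv_ne_zero hd)

theorem AEExpDecay.comp_swap {F : E n × E n → ℂ} (h : AEExpDecay (fun z => ‖z.1‖ + ‖z.2‖) F) :
    AEExpDecay (fun z => ‖z.1‖ + ‖z.2‖) fun z : E n × E n => F z.swap :=
  h.comp_of_le Measure.measurePreserving_swap.quasiMeasurePreserving one_pos fun z => by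
    rw [one_mul, add_comm]; rfl

theorem aeExpDecay_comp_swap_iff {F : E n × E n → ℂ} :
    AEExpDecay (fun z => ‖z.1‖ + ‖z.2‖) (fun z : E n × E n => F z.swap) ↔
      AEExpDecay (fun z => ‖z.1‖ + ‖z.2‖) F :=
  ⟨fun h => by simpa only [Prod.swap_swap] using h.comp_swap, fun h => h.comp_swap⟩

end AEExpDecay

/-! ### The kernel of the integrated representation -/

section Kernel

variable {n : ℕ} (lam : ℝ)

/-- `∫∫ f(x,u,t) e^{i lam (t + m·x)} dt dx`; the operator `π_lam(f)` has the integral kernel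
`(ξ, η) ↦ kern lam f ((ξ + η) / 2) (η - ξ)`. -/
def kern (f : H n → ℂ) (m u : E n) : ℂ :=
  ∫ x, centralFourier lam f x u * Complex.exp (Complex.I * ((lam * inner ℝ m x : ℝ) : ℂ))

/-- Exponential decay of the kernel of `π_lam(f)`. -/
def KernDecay (f : H n → ℂ) : Prop :=
  AEExpDecay (fun z => ‖z.1‖ + ‖z.2‖) fun z : E n × E n => kern lam f z.1 z.2

variable {lam}

theorem kern_congr {f g : H n → ℂ} (h : f =ᵐ[volume] g) :
    ∀ᵐ u, ∀ m, kern lam f m u = kern lam g m u := by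
  filter_upwards [ae_iterated h] with u hu m
  refine integral_congr_ae ?_
  filter_upwards [hu] with x hx
  congr 1
  refine integral_congr_ae ?_
  filter_upwards [hx] with t ht
  rw [ht]

theorem KernDecay.congr {f g : H n → ℂ} (hf : KernDecay lam f) (h : f =ᵐ[volume] g) :
    KernDecay lam g :=
  AEExpDecay.congr hf
    ((Measure.quasiMeasurePreserving_snd.ae (kern_congr h)).mono fun z hz => hz z.1)

theorem two_pi_rpow_mul_rpow_neg (a : ℝ) : (2 * π) ^ (a / 2) * (2 * π) ^ (-a / 2) = 1 := by
  rw [← Real.rpow_add (by positivity), neg_div, add_neg_cancel, Real.rpow_zero]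

theorem kern_eq_fourier1 (f : H n → ℂ) (m u : E n) :
    kern lam f m u = (((2 * π) ^ ((n : ℝ) / 2) : ℝ) : ℂ) *
      fourier1 (centralFourier lam f) ((-lam) • m) u := by
  rw [fourier1, ← mul_assoc, ← Complex.ofReal_mul, two_pi_rpow_mul_rpow_neg, Complex.ofReal_one,
    one_mul, kern]
  refine integral_congr_ae (.of_forall fun x => ?_)
  simp only [real_inner_smul_left]
  congr 2
  push_cast
  ring

theorem kern_comp_fourierAut (hlam : lam ≠ 0) (f : H n → ℂ) (m u : E n) :
    kern lam (f ∘ fourierAut lam) m u =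
      ((|((-(lam / (2 * π))) ^ n)⁻¹| * (2 * π) ^ ((n : ℝ) / 2) : ℝ) : ℂ) *
      fourier2 (centralFourier lam f) ((2 * π / lam) • u) ((2 * π) • m) := by
  rw [fourier2, ← mul_assoc, ← Complex.ofReal_mul, mul_assoc, two_pi_rpow_mul_rpow_neg, mul_one,
    kern]
  have hscale := Measure.integral_comp_smul (volume : Measure (E n)) (fun v : E n =>
    centralFourier lam f ((2 * π / lam) • u) v *
      Complex.exp (-Complex.I * ((inner ℝ ((2 * π) • m) v : ℝ) : ℂ))) (-(lam / (2 * π)))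
  rw [finrank_euclideanSpace_fin, Complex.real_smul] at hscale
  rw [← hscale]
  refine integral_congr_ae (.of_forall fun x => ?_)
  simp only [centralFourier, Function.comp, fourierAut, neg_smul, real_inner_smul_left,
    inner_neg_right, real_inner_smul_right]
  congr 2
  have : (π : ℂ) ≠ 0 := by exact_mod_cast Real.pi_ne_zero
  have : (lam : ℂ) ≠ 0 := by exact_mod_cast hlam
  push_cast
  field_simp

theorem kernDecay_iff_fourier1 (hlam : lam ≠ 0) (f : H n → ℂ) : KernDecay lam f ↔
    AEExpDecay (fun z => √((1 / |lam|) * ‖z.1‖ ^ 2 + (|lam| / 4) * ‖z.2‖ ^ 2))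
      fun z : E n × E n => fourier1 (centralFourier lam f) z.1 z.2 := by
  have : 0 < |lam| := abs_pos.2 hlam
  rw [aeExpDecay_sqrt_iff (by positivity) (by positivity),
    ← aeExpDecay_comp_smul_iff (neg_ne_zero.2 hlam) one_ne_zero, KernDecay]
  simp only [kern_eq_fourier1, one_smul]
  exact aeExpDecay_const_mul_iff (Complex.ofReal_ne_zero.2 (by positivity))

theorem kernDecay_comp_iff_fourier2 (hlam : lam ≠ 0) (f : H n → ℂ) :
    KernDecay lam (f ∘ fourierAut lam) ↔
      AEExpDecay (fun z => √((|lam| / 4) * ‖z.1‖ ^ 2 + (1 / |lam|) * ‖z.2‖ ^ 2))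
        fun z : E n × E n => fourier2 (centralFourier lam f) z.1 z.2 := by
  have : 0 < |lam| := abs_pos.2 hlam
  have hscale : -(lam / (2 * π)) ≠ 0 := neg_ne_zero.2 (div_ne_zero hlam (by positivity))
  rw [aeExpDecay_sqrt_iff (by positivity) (by positivity),
    ← aeExpDecay_comp_smul_iff (div_ne_zero (by positivity : 2 * π ≠ 0) hlam)
      (by positivity : 2 * π ≠ 0), ← aeExpDecay_comp_swap_iff, KernDecay]
  simp only [kern_comp_fourierAut hlam]
  exact aeExpDecay_const_mul_iff (Complex.ofReal_ne_zero.2 (by positivity))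

theorem mem_B_iff (hlam : lam ≠ 0) (f : L1 n) :
    f ∈ B n lam ↔ KernDecay lam f ∧ KernDecay lam (f ∘ fourierAut lam) := by
  rw [kernDecay_iff_fourier1 hlam, kernDecay_comp_iff_fourier2 hlam]
  refine ⟨fun ⟨t, ht, C, h1, h2⟩ => ⟨⟨t, ht, C, h1⟩, ⟨t, ht, C, h2⟩⟩, fun ⟨h1, h2⟩ => ?_⟩
  exact h1.exists_common (fun _ => Real.sqrt_nonneg _) (fun _ => Real.sqrt_nonneg _) h2

end Kernel

/-! ### The integrated representation as an integral operator -/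

section IntegralOperator

variable {n : ℕ} {lam : ℝ}

theorem quasiMeasurePreserving_add_translation :
    Measure.QuasiMeasurePreserving (fun z : H n × E n => z.2 + z.1.2.1)
      (volume.prod volume) volume := by
  have h : MeasurePreserving (fun z : H n × E n => (z.1, z.2 + z.1.2.1))
      (volume.prod volume) (volume.prod volume) :=
    MeasurePreserving.skew_product (f := fun p : H n => p) (g := fun p ξ => ξ + p.2.1)
      (MeasurePreserving.id volume) (Continuous.measurable (by fun_prop))
      (.of_forall fun p => (measurePreserving_add_right volume p.2.1).map_eq)
  exact Measure.quasiMeasurePreserving_snd.comp h.quasiMeasurePreserving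

theorem integral_norm_mul_norm_le {α : Type*} [MeasurableSpace α] {μ : Measure α}
    (g φ : Lp ℂ 2 μ) : ∫ x, ‖g x‖ * ‖φ x‖ ∂μ ≤ ‖g‖ * ‖φ‖ := by
  have hg : MemLp (fun x => ‖g x‖) 2 μ := (Lp.memLp g).norm
  have hφ : MemLp (fun x => ‖φ x‖) 2 μ := (Lp.memLp φ).norm
  have h := real_inner_le_norm hg.toLp hφ.toLp
  rw [L2.inner_def, Lp.norm_toLp, Lp.norm_toLp, eLpNorm_norm, eLpNorm_norm, ← Lp.norm_def,
    ← Lp.norm_def] at h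
  refine (integral_congr_ae ?_).trans_le h
  filter_upwards [hg.coeFn_toLp, hφ.coeFn_toLp] with x e1 e2
  rw [e1, e2, real_inner_comm, RCLike.inner_apply, conj_trivial]

theorem integral_norm_mul_schrodingerFun_le (g φ : V n) (p : H n) :
    ∫ ξ, ‖starRingEnd ℂ (g ξ) * schrodingerFun lam p φ ξ‖ ≤ ‖g‖ * ‖φ‖ := by
  rw [← norm_schrodinger lam p φ]
  refine (integral_congr_ae ?_).trans_le (integral_norm_mul_norm_le g _)
  filter_upwards [schrodinger_coeFn lam p φ] with ξ hξ
  rw [hξ, norm_mul, RCLike.norm_conj]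

theorem aestronglyMeasurable_mul_schrodingerFun {f : H n → ℂ} (hf : AEStronglyMeasurable f)
    (g φ : V n) : AEStronglyMeasurable (fun z : H n × E n =>
      f z.1 * (starRingEnd ℂ (g z.2) * schrodingerFun lam z.1 φ z.2)) (volume.prod volume) := by
  refine hf.comp_fst.mul (AEStronglyMeasurable.mul ?_ (AEStronglyMeasurable.mul ?_ ?_))
  · exact Complex.continuous_conj.comp_aestronglyMeasurable (Lp.memLp g).1.comp_snd
  · exact Continuous.aestronglyMeasurable (by fun_prop)
  · exact (Lp.memLp φ).1.comp_quasiMeasurePreserving quasiMeasurePreserving_add_translation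

theorem integrable_mul_schrodingerFun {f : H n → ℂ} (hf : Integrable f) (g φ : V n) :
    Integrable (fun z : H n × E n =>
      f z.1 * (starRingEnd ℂ (g z.2) * schrodingerFun lam z.1 φ z.2)) (volume.prod volume) := by
  have hm := aestronglyMeasurable_mul_schrodingerFun (lam := lam) hf.1 g φ
  rw [integrable_prod_iff hm]
  refine ⟨.of_forall fun p => ((Lp.memLp g).star.integrable_mul
    (memLp_schrodingerFun lam p φ)).const_mul (f p), ?_⟩
  refine (hf.norm.mul_const (‖g‖ * ‖φ‖)).mono' hm.norm.integral_prod_right' (.of_forall fun p => ?_)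
  rw [Real.norm_of_nonneg (integral_nonneg fun _ => norm_nonneg _)]
  simp only [norm_mul (f p)]
  rw [integral_const_mul]
  gcongr
  exact integral_norm_mul_schrodingerFun_le g φ p

theorem inner_smul_schrodinger (c : ℂ) (g φ : V n) (p : H n) :
    inner ℂ g (c • schrodinger lam p φ) =
      ∫ ξ, c * (starRingEnd ℂ (g ξ) * schrodingerFun lam p φ ξ) := by
  rw [inner_smul_right, L2.inner_def, integral_const_mul]
  congr 1
  refine integral_congr_ae ?_
  filter_upwards [schrodinger_coeFn lam p φ] with ξ hξ
  rw [hξ, RCLike.inner_apply']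

theorem inner_integral_smul_schrodinger (hlam : lam ≠ 0) {f : H n → ℂ} (hf : Integrable f)
    (g φ : V n) : inner ℂ g (∫ p, f p • schrodinger lam p φ) =
      ∫ ξ, ∫ u, starRingEnd ℂ (g ξ) * (kern lam f (ξ + (1 / 2 : ℝ) • u) u * φ (ξ + u)) := by
  have hi := integrable_mul_schrodingerFun (lam := lam) hf g φ
  rw [← integral_inner (integrable_smul_schrodinger hlam hf φ)]
  simp only [inner_smul_schrodinger]
  rw [integral_integral_swap hi]
  refine integral_congr_ae ?_
  filter_upwards [hi.prod_left_ae] with ξ hξ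
  rw [integral_iterated hξ]
  refine integral_congr_ae (.of_forall fun u => ?_)
  simp only [kern, centralFourier]
  rw [← integral_mul_const, ← integral_const_mul]
  refine integral_congr_ae (.of_forall fun x => ?_)
  simp only
  rw [← integral_mul_const, ← integral_mul_const, ← integral_const_mul]
  refine integral_congr_ae (.of_forall fun t => ?_)
  have : inner ℝ (ξ + (1 / 2 : ℝ) • u) x = inner ℝ x ξ + 1 / 2 * inner ℝ x u := by
    rw [inner_add_left, real_inner_smul_left, real_inner_comm, real_inner_comm u]
  simp only [schrodingerFun, this]
  ring

theorem norm_add_norm_le (ξ u : E n) :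
    ‖ξ‖ + ‖ξ + u‖ ≤ 2 * (‖ξ + (1 / 2 : ℝ) • u‖ + ‖u‖) := by
  have h1 : ‖ξ‖ ≤ ‖ξ + (1 / 2 : ℝ) • u‖ + ‖(1 / 2 : ℝ) • u‖ := by
    simpa using norm_sub_le (ξ + (1 / 2 : ℝ) • u) ((1 / 2 : ℝ) • u)
  have h2 : ‖ξ + u‖ ≤ ‖ξ + (1 / 2 : ℝ) • u‖ + ‖(1 / 2 : ℝ) • u‖ := by
    rw [show ξ + u = (ξ + (1 / 2 : ℝ) • u) + (1 / 2 : ℝ) • u by module]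
    exact norm_add_le _ _
  have h3 : ‖(1 / 2 : ℝ) • u‖ = 1 / 2 * ‖u‖ := by
    rw [norm_smul, Real.norm_of_nonneg (by norm_num)]
  linarith [norm_nonneg u]

theorem measurePreserving_shear (c : ℝ) :
    MeasurePreserving fun z : E n × E n => (z.1 + c • z.2, z.2) := by
  have h : MeasurePreserving (fun z : E n × E n => (z.1, z.2 + c • z.1))
      (volume.prod volume) (volume.prod volume) :=
    MeasurePreserving.skew_product (f := fun p : E n => p) (g := fun p ξ => ξ + c • p)
      (MeasurePreserving.id volume) (Continuous.measurable (by fun_prop))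
      (.of_forall fun p => (measurePreserving_add_right volume (c • p)).map_eq)
  exact (Measure.measurePreserving_swap.comp h).comp Measure.measurePreserving_swap

theorem KernDecay.exists_norm_le {f : H n → ℂ} (hf : KernDecay lam f) :
    ∃ t : ℝ, 0 < t ∧ ∃ C : ℝ, 0 ≤ C ∧ ∀ᵐ z : E n × E n,
      ‖kern lam f (z.1 + (1 / 2 : ℝ) • z.2) z.2‖ ≤
        C * (Real.exp (-t * ‖z.1‖) * Real.exp (-t * ‖z.1 + z.2‖)) := by
  obtain ⟨t, ht, C, hC⟩ := hf
  refine ⟨t / 2, by positivity, |C|, abs_nonneg C, ?_⟩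
  filter_upwards [(measurePreserving_shear (1 / 2)).quasiMeasurePreserving.ae hC] with z hz
  refine hz.trans ?_
  rw [← Real.exp_add]
  gcongr
  · exact le_abs_self C
  · linarith [mul_le_mul_of_nonneg_left (norm_add_norm_le z.1 z.2) ht.le]

theorem KernDecay.exists_ae_norm_schrodingerInt_le (hlam : lam ≠ 0) {f : L1 n}
    (hf : KernDecay lam f) (φ : V n) : ∃ t : ℝ, 0 < t ∧ ∃ C : ℝ, 0 ≤ C ∧
      ∀ᵐ ξ, ‖schrodingerInt lam f φ ξ‖ ≤ C * Real.exp (-t * ‖ξ‖) := by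
  obtain ⟨t, ht, C, hC0, hC⟩ := hf.exists_norm_le
  set M := ∫ η, Real.exp (-t * ‖η‖) * ‖φ η‖
  have hint : Integrable fun η : E n => Real.exp (-t * ‖η‖) * ‖φ η‖ :=
    (memLp_two_exp_neg_mul_norm ht).integrable_mul (Lp.memLp φ).norm
  have : 0 ≤ M := integral_nonneg fun _ => by positivity
  have hw : MemLp (fun ξ : E n => C * M * Real.exp (-t * ‖ξ‖)) 2 volume :=
    (memLp_two_exp_neg_mul_norm ht).const_mul (C * M)
  refine ⟨t, ht, C * M, by positivity, ?_⟩
  refine norm_le_of_norm_inner_le (schrodingerInt lam f φ) hw (fun ξ => by positivity) fun g => ?_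
  rw [schrodingerInt, inner_integral_smul_schrodinger hlam (L1.integrable_coeFn f)]
  refine norm_integral_le_of_norm_le ((Lp.memLp g).norm.integrable_mul hw) ?_
  filter_upwards [Measure.ae_ae_of_ae_prod hC] with ξ hξ
  have hM : ∫ u, Real.exp (-t * ‖ξ + u‖) * ‖φ (ξ + u)‖ = M :=
    integral_add_left_eq_self (fun η => Real.exp (-t * ‖η‖) * ‖φ η‖) ξ
  refine (norm_integral_le_of_norm_le
    ((hint.comp_add_left ξ).const_mul (‖g ξ‖ * C * Real.exp (-t * ‖ξ‖))) ?_).trans_eq ?_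
  · filter_upwards [hξ] with u hu
    rw [norm_mul, norm_mul, RCLike.norm_conj]
    calc _ ≤ ‖g ξ‖ * ((C * (Real.exp (-t * ‖ξ‖) * Real.exp (-t * ‖ξ + u‖))) * ‖φ (ξ + u)‖) := by
          gcongr
      _ = _ := by ring
  · rw [integral_const_mul, hM]
    ring

theorem KernDecay.expWeighted (hlam : lam ≠ 0) {f : L1 n} (hf : KernDecay lam f) (φ : V n) :
    ExpWeighted (schrodingerInt lam f φ : V n) := by
  obtain ⟨t, ht, C, -, hC⟩ := hf.exists_ae_norm_schrodingerInt_le hlam φ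
  refine ⟨t / 2, by positivity, ?_⟩
  refine (memLp_two_exp_neg_mul_norm (half_pos ht)).of_le_mul (c := C) ?_ ?_
  · exact AEStronglyMeasurable.mul (Continuous.aestronglyMeasurable (by fun_prop))
      (Lp.memLp _).1.norm
  · filter_upwards [hC] with ξ hξ
    rw [Real.norm_of_nonneg (by positivity), Real.norm_of_nonneg (by positivity)]
    calc _ ≤ Real.exp (t / 2 * ‖ξ‖) * (C * Real.exp (-t * ‖ξ‖)) := by gcongr
      _ = C * (Real.exp (t / 2 * ‖ξ‖) * Real.exp (-t * ‖ξ‖)) := by ring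
      _ = _ := by rw [← Real.exp_add]; congr 2; ring

theorem fourier_integral_smul_schrodinger (hlam : lam ≠ 0) {f : H n → ℂ} (hf : Integrable f)
    (φ : V n) : (𝓕 (∫ p, f (fourierAut lam p) • schrodinger lam p φ : V n) : V n) =
      ∫ p, f p • schrodinger lam p (𝓕 φ) := by
  have hi : Integrable (fun p => f (fourierAut lam p)) :=
    (measurePreserving_fourierAut hlam).integrable_comp_of_integrable hf
  have h := ((Lp.fourierTransformₗᵢ (E n) ℂ).toContinuousLinearEquiv :
    V n →L[ℂ] V n).integral_comp_comm (integrable_smul_schrodinger hlam hi φ)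
  refine h.symm.trans ?_
  rw [← integral_comp_fourierAut hlam fun p => f p • schrodinger lam p (𝓕 φ)]
  refine integral_congr_ae (.of_forall fun p => ?_)
  simp only [← fourier_schrodinger hlam]
  exact (Lp.fourierTransformₗᵢ (E n) ℂ).map_smul _ _

end IntegralOperator

/-! ### Functions that decay exponentially together with their Fourier transform -/

section DecayPair

variable {F : Type*} [NormedAddCommGroup F] [InnerProductSpace ℝ F] [FiniteDimensional ℝ F]
  [MeasurableSpace F] [BorelSpace F] {ψ : F → ℂ}

/-- `ψ` is continuous and decays exponentially, as does its Fourier transform: the pointwise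
description of analytic vectors. -/
structure DecayPair (ψ : F → ℂ) : Prop where
  continuous : Continuous ψ
  decay : ExpDecay ψ
  decay_fourier : ExpDecay (𝓕 ψ)

theorem DecayPair.integrable (h : DecayPair ψ) : Integrable ψ :=
  h.decay.integrable h.continuous.aestronglyMeasurable

theorem DecayPair.memLp (h : DecayPair ψ) : MemLp ψ 2 volume :=
  h.decay.memLp h.continuous.aestronglyMeasurable

theorem DecayPair.integrable_fourier (h : DecayPair ψ) : Integrable (𝓕 ψ) :=
  h.decay_fourier.integrable (continuous_fourier h.integrable).aestronglyMeasurable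

theorem DecayPair.fourierInv (h : DecayPair ψ) : DecayPair (𝓕⁻ ψ) where
  continuous := continuous_fourierInv h.integrable
  decay := by
    rw [funext fun w => Real.fourierInv_eq_fourier_neg ψ w]
    exact h.decay_fourier.comp_neg
  decay_fourier := by
    rw [h.continuous.fourier_fourierInv_eq h.integrable h.integrable_fourier]
    exact h.decay

theorem DecayPair.fourier (h : DecayPair ψ) : DecayPair (𝓕 ψ) where
  continuous := continuous_fourier h.integrable
  decay := h.decay_fourier
  decay_fourier := by
    have hinv := h.continuous.fourierInv_fourier_eq h.integrable h.integrable_fourier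
    have htwice : 𝓕 (𝓕 ψ) = fun w => ψ (-w) := by
      funext w
      rw [← congrFun hinv (-w), Real.fourierInv_eq_fourier_neg, neg_neg]
    rw [htwice]
    exact h.decay.comp_neg

theorem exists_decayPair (ψ : Lp (α := F) ℂ 2 volume) (h : ExpWeighted ψ)
    (h' : ExpWeighted (𝓕 ψ : Lp (α := F) ℂ 2 volume)) :
    ∃ ψ₀ : F → ℂ, DecayPair ψ₀ ∧ ψ =ᵐ[volume] ψ₀ := by
  set η : Lp (α := F) ℂ 2 volume := 𝓕 ψ
  have hψi := h.integrable (Lp.memLp ψ).1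
  have hηi := h'.integrable (Lp.memLp η).1
  have hψ : ψ = 𝓕⁻ η := ((Lp.fourierTransformₗᵢ F ℂ).symm_apply_apply ψ).symm
  set ψ₀ : F → ℂ := 𝓕⁻ (η : F → ℂ)
  have hψ₀ : ψ =ᵐ[volume] ψ₀ := by
    have := fourierInv_coeFn η hηi
    rwa [← hψ] at this
  have hneg : ψ₀ = 𝓕 (η : F → ℂ) ∘ Neg.neg := funext fun w => Real.fourierInv_eq_fourier_neg _ w
  have hfourier : 𝓕 ψ₀ = 𝓕 (ψ : F → ℂ) := funext fun w => Real.fourier_congr_ae hψ₀.symm w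
  refine ⟨ψ₀, ⟨continuous_fourierInv hηi, ?_, ?_⟩, hψ₀⟩
  · obtain ⟨K, hK⟩ := exists_lipschitzWith_fourier hηi (h'.integrable_norm_mul (Lp.memLp η).1)
    refine (h.congr hψ₀).expDecay (K := K * 1) ?_ (M := ∫ v, ‖η v‖) fun ξ => ?_ <;> rw [hneg]
    · exact hK.comp LipschitzWith.id.neg
    · exact norm_fourier_le η (-ξ)
  · obtain ⟨K, hK⟩ := exists_lipschitzWith_fourier hψi (h.integrable_norm_mul (Lp.memLp ψ).1)
    rw [hfourier]
    exact (h'.congr (fourier_coeFn ψ hψi)).expDecay hK (norm_fourier_le ψ)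

end DecayPair

section SchrodingerInt

variable {n : ℕ} {lam : ℝ}

theorem kern_comp_neg (f : H n → ℂ) (m u : E n) :
    kern lam (fun p => f (-p.1, -p.2.1, p.2.2)) m u = kern lam f (-m) (-u) := by
  rw [kern, kern, ← integral_neg_eq_self]
  refine integral_congr_ae (.of_forall fun x => ?_)
  simp [centralFourier]

theorem KernDecay.comp_neg {f : H n → ℂ} (h : KernDecay lam f) :
    KernDecay lam fun p => f (-p.1, -p.2.1, p.2.2) := by
  have hneg : (-1 : ℝ) ≠ 0 := neg_ne_zero.2 one_ne_zero
  simpa only [KernDecay, kern_comp_neg, neg_smul, one_smul] using AEExpDecay.comp_smul h hneg hneg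

theorem exists_decayPair_schrodingerInt (hlam : lam ≠ 0) {f : L1 n} (hf : f ∈ B n lam) (φ : V n) :
    ∃ ψ : E n → ℂ, DecayPair ψ ∧ schrodingerInt lam f φ =ᵐ[volume] ψ := by
  obtain ⟨h1, h2⟩ := (mem_B_iff hlam f).1 hf
  refine exists_decayPair _ (h1.expWeighted hlam φ) ?_
  -- `𝓕 π(f)φ = π(f ∘ A³)𝓕φ` for the automorphism `A = fourierAut lam` of order four.
  have hdecay : KernDecay lam fun p =>
      f (fourierAut lam (fourierAut lam (fourierAut lam p))) := by
    simpa only [← fourierAut_fourierAut hlam, Function.comp_apply] using h2.comp_neg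
  have hA := measurePreserving_fourierAut (n := n) hlam
  have hi : Integrable fun p => f (fourierAut lam (fourierAut lam (fourierAut lam p))) :=
    (hA.comp (hA.comp hA)).integrable_comp_of_integrable (L1.integrable_coeFn f)
  have hfourier := fourier_integral_smul_schrodinger hlam hi φ
  simp only [fourierAut_four hlam] at hfourier
  rw [schrodingerInt, hfourier, ← schrodingerInt_toL1 hi]
  exact (hdecay.congr hi.coeFn_toL1.symm).expWeighted hlam _

end SchrodingerInt

/-! ### Analytic vectors decay exponentially -/

section AnalyticMultiplier

theorem exists_norm_iteratedDeriv_le {F : Type*} [NormedAddCommGroup F] [NormedSpace ℝ F]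
    [CompleteSpace F] {g : ℝ → F} {s : ℝ} (hg : AnalyticAt ℝ g s) :
    ∃ R : ℝ, 0 < R ∧ ∃ C : ℝ, ∀ k : ℕ, ‖iteratedDeriv k g s‖ ≤ C * R ^ k * k.factorial := by
  obtain ⟨p, r, hp⟩ := hg
  obtain ⟨ρ, hρ0, hρ⟩ := ENNReal.lt_iff_exists_nnreal_btwn.1 (hp.r_pos.trans_le hp.r_le)
  have hρ0' : (0 : ℝ) < ρ := by exact_mod_cast hρ0
  obtain ⟨C, -, hb⟩ := p.norm_mul_pow_le_of_lt_radius hρ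
  refine ⟨(ρ : ℝ)⁻¹, by positivity, C, fun k => ?_⟩
  rw [iteratedDeriv_eq_iteratedFDeriv, ← hp.factorial_smul, ← Nat.cast_smul_eq_nsmul ℝ, norm_smul,
    Real.norm_of_nonneg (by positivity), mul_comm]
  gcongr
  calc ‖p k fun _ => (1 : ℝ)‖ ≤ ‖p k‖ := by simp
    _ ≤ C * (ρ : ℝ)⁻¹ ^ k := by
      rw [inv_pow, ← div_eq_mul_inv, le_div_iff₀ (by positivity)]
      exact hb k

variable {Ω G : Type*} [MeasurableSpace Ω] {μ : Measure Ω} {p : ℝ≥0∞} [Fact (1 ≤ p)]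
  [NormedAddCommGroup G]

theorem coeFn_ae_eq_of_hasDerivAt [NormedSpace ℝ G] {K : ℝ → Lp G p μ} {k : ℝ → Ω → G}
    {c : Lp G p μ} {c' : Ω → G} {s : ℝ} (hK : ∀ s, K s =ᵐ[μ] k s) (h : HasDerivAt K c s)
    (h' : ∀ x, HasDerivAt (k · x) (c' x) s) : c =ᵐ[μ] c' := by
  set u : ℕ → ℝ := fun j => 1 / ((j : ℝ) + 1)
  have hu : Tendsto u atTop (𝓝[≠] 0) :=
    tendsto_nhdsWithin_iff.2 ⟨tendsto_one_div_add_atTop_nhds_zero_nat,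
      .of_forall fun j => (Nat.one_div_pos_of_nat).ne'⟩
  obtain ⟨ns, hns, hlim⟩ :=
    (tendstoInMeasure_of_tendsto_Lp (h.tendsto_slope_zero.comp hu)).exists_seq_tendsto_ae
  have hslope : ∀ᵐ x ∂μ, ∀ j, ((u j)⁻¹ • (K (s + u j) - K s) : Lp G p μ) x =
      (u j)⁻¹ • (k (s + u j) x - k s x) := ae_all_iff.2 fun j => by
    filter_upwards [Lp.coeFn_smul (u j)⁻¹ (K (s + u j) - K s), Lp.coeFn_sub (K (s + u j)) (K s),
      hK (s + u j), hK s] with x e1 e2 e3 e4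
    rw [e1, Pi.smul_apply, e2, Pi.sub_apply, e3, e4]
  filter_upwards [hlim, hslope] with x hx hslope
  refine tendsto_nhds_unique hx
    ((((h' x).tendsto_slope_zero.comp hu).comp hns.tendsto_atTop).congr fun j => ?_)
  exact (hslope (ns j)).symm

theorem iteratedDeriv_expMultiplier {J : ℝ → Lp ℂ p μ} {z φ : Ω → ℂ}
    (hJ : ∀ s, J s =ᵐ[μ] fun x => Complex.exp (s * z x) * φ x) (h : ContDiff ℝ (⊤ : ℕ∞) J)
    (k : ℕ) : ∀ s, (iteratedDeriv k J s : Lp ℂ p μ) =ᵐ[μ]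
      fun x => Complex.exp (s * z x) * (z x ^ k * φ x) := by
  induction k with
  | zero => simpa using hJ
  | succ k ih =>
    intro s
    rw [iteratedDeriv_succ]
    have hd := h.differentiable_iteratedDeriv k (by exact_mod_cast ENat.natCast_lt_top k)
    refine coeFn_ae_eq_of_hasDerivAt ih (hd s).hasDerivAt fun x => ?_
    have hlin : HasDerivAt (fun s : ℝ => (s : ℂ) * z x) (z x) s := by
      simpa using (Complex.ofRealCLM.hasDerivAt (x := s)).mul_const (z x)
    exact (hlin.cexp.mul_const (z x ^ k * φ x)).congr_deriv (by ring)

theorem memLp_exp_mul_norm {c : ℕ → Lp G p μ} {y : Ω → ℝ} {φ : Ω → G} {C R r : ℝ} (hr : 0 ≤ r)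
    (hR : 0 ≤ R) (hrR : r * R < 1) (hc : ∀ k, ∀ᵐ x ∂μ, ‖c k x‖ = y x ^ k * ‖φ x‖)
    (hb : ∀ k, ‖c k‖ ≤ C * R ^ k * k.factorial) :
    MemLp (fun x => Real.exp (r * y x) * ‖φ x‖) p μ := by
  set d : ℕ → Lp ℝ p μ := fun k => (r ^ k / k.factorial) • (Lp.memLp (c k)).norm.toLp
  have hd : ∀ᵐ x ∂μ, ∀ k, d k x = (r * y x) ^ k / k.factorial * ‖φ x‖ := ae_all_iff.2 fun k => by
    filter_upwards [Lp.coeFn_smul (r ^ k / k.factorial : ℝ) (Lp.memLp (c k)).norm.toLp,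
      (Lp.memLp (c k)).norm.coeFn_toLp, hc k] with x e1 e2 e3
    rw [e1, Pi.smul_apply, e2, e3, smul_eq_mul]
    ring
  have hnorm k : ‖d k‖ ≤ C * (r * R) ^ k := by
    rw [norm_smul, Lp.norm_toLp, eLpNorm_norm, ← Lp.norm_def, Real.norm_of_nonneg (by positivity)]
    calc r ^ k / k.factorial * ‖c k‖ ≤ r ^ k / k.factorial * (C * R ^ k * k.factorial) := by
          gcongr
          exact hb k
      _ = C * (r * R) ^ k := by rw [mul_pow]; field_simp
  have hsum : ∑' k, ‖d k‖ₑ ≠ ⊤ := tsum_enorm_ne_top_iff_summable_norm.2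
    (.of_nonneg_of_le (fun _ => norm_nonneg _) hnorm
      ((summable_geometric_of_lt_one (by positivity) hrR).mul_left C))
  refine (Lp.memLp (∑' k, d k)).ae_eq ?_
  filter_upwards [Lp.hasSum_coeFn_tsum hsum, hd] with x hx hdx
  simp only [hdx] at hx
  rw [Real.exp_eq_exp_ℝ]
  exact hx.unique ((NormedSpace.expSeries_div_hasSum_exp (r * y x)).mul_right ‖φ x‖)

/-- A converse of `analyticAt_expMultiplier` in one real parameter. -/
theorem exists_memLp_exp_mul_norm {J : ℝ → Lp ℂ p μ} {z φ : Ω → ℂ}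
    (hJ : ∀ s, J s =ᵐ[μ] fun x => Complex.exp (s * z x) * φ x)
    (h : AnalyticOnNhd ℝ J Set.univ) :
    ∃ r : ℝ, 0 < r ∧ MemLp (fun x => Real.exp (r * ‖z x‖) * ‖φ x‖) p μ := by
  obtain ⟨R, hR, C, hb⟩ := exists_norm_iteratedDeriv_le (h 0 (Set.mem_univ _))
  refine ⟨(2 * R)⁻¹, by positivity, memLp_exp_mul_norm (by positivity) hR.le ?_ (fun k => ?_) hb⟩
  · rw [mul_inv, mul_assoc, inv_mul_cancel₀ hR.ne']
    norm_num
  · filter_upwards [iteratedDeriv_expMultiplier hJ h.contDiff k 0] with x hx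
    rw [hx]
    simp

end AnalyticMultiplier

section AnalyticVector

variable {n : ℕ} {lam : ℝ}

theorem exists_norm_le_mul_abs [NeZero n] (ξ : E n) : ∃ j, ‖ξ‖ ≤ n * |ξ j| := by
  obtain ⟨j, hj⟩ := Finite.exists_max fun i => |ξ i|
  have hn : (1 : ℝ) ≤ n := by exact_mod_cast NeZero.one_le
  refine ⟨j, ?_⟩
  rw [EuclideanSpace.norm_eq]
  refine Real.sqrt_le_iff.2 ⟨by positivity, ?_⟩
  calc ∑ i, ‖ξ i‖ ^ 2 ≤ ∑ _i : Fin n, |ξ j| ^ 2 :=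
        Finset.sum_le_sum fun i _ => pow_le_pow_left₀ (norm_nonneg _) (hj i) 2
    _ = n * |ξ j| ^ 2 := by simp
    _ ≤ n ^ 2 * |ξ j| ^ 2 := by
      gcongr
      exact le_self_pow₀ hn two_ne_zero
    _ = _ := (mul_pow _ _ _).symm

theorem expWeighted_of_memLp_coord {ψ : E n → ℂ} (hψ : MemLp ψ 2 volume)
    (h : ∀ j, ∃ r : ℝ, 0 < r ∧ MemLp (fun ξ : E n => Real.exp (r * |ξ j|) * ‖ψ ξ‖) 2 volume) :
    ExpWeighted ψ := by
  rcases eq_zero_or_neZero n with rfl | hn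
  · exact ⟨1, one_pos, by simp [Subsingleton.elim _ (0 : E 0)]⟩
  choose r hr h using h
  obtain ⟨i, hi⟩ := Finite.exists_min r
  have hn0 : (0 : ℝ) < n := by exact_mod_cast NeZero.pos n
  have hri := hr i
  refine ⟨r i / n, by positivity, ?_⟩
  have hsum : MemLp (fun ξ : E n => ∑ j, Real.exp (r j * |ξ j|) * ‖ψ ξ‖) 2 volume :=
    memLp_finsetSum _ fun j _ => h j
  refine hsum.of_le (.mul (Continuous.aestronglyMeasurable (by fun_prop)) hψ.1.norm)
    (.of_forall fun ξ => ?_)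
  obtain ⟨j, hj⟩ := exists_norm_le_mul_abs ξ
  have hexp : r i / n * ‖ξ‖ ≤ r j * |ξ j| := by
    calc r i / n * ‖ξ‖ ≤ r i / n * (n * |ξ j|) := by gcongr
      _ = r i * |ξ j| := by field_simp
      _ ≤ _ := by gcongr; exact hi j
  rw [Real.norm_of_nonneg (by positivity), Real.norm_of_nonneg (by positivity), ← Finset.sum_mul]
  gcongr
  exact (Real.exp_le_exp.2 hexp).trans (Finset.single_le_sum
    (f := fun j => Real.exp (r j * |ξ j|)) (fun j _ => (Real.exp_pos _).le) (Finset.mem_univ j))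

theorem schrodinger_modulation_coeFn (a : E n) (s : ℝ) (ψ : V n) :
    schrodinger lam (s • a, 0, 0) ψ =ᵐ[volume]
      fun ξ => Complex.exp (s * (Complex.I * ((lam * inner ℝ a ξ : ℝ) : ℂ))) * ψ ξ := by
  filter_upwards [schrodinger_coeFn lam (s • a, 0, 0) ψ] with ξ hξ
  refine hξ.trans ?_
  simp only [schrodingerFun, mul_zero, Complex.ofReal_zero, Complex.exp_zero, one_mul,
    inner_zero_right, add_zero, real_inner_smul_left]
  congr 2
  push_cast
  ring

theorem expWeighted_of_mem_analyticVectors (hlam : lam ≠ 0) {ψ : V n}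
    (h : ψ ∈ analyticVectors n lam) : ExpWeighted ψ := by
  refine expWeighted_of_memLp_coord (Lp.memLp ψ) fun j => ?_
  have hanalytic : AnalyticOnNhd ℝ (fun s : ℝ =>
      schrodinger lam (s • EuclideanSpace.single j (1 : ℝ), 0, 0) ψ) Set.univ := fun s _ =>
    (h _ (Set.mem_univ _)).fun_comp ((analyticAt_id.smul analyticAt_const).prod analyticAt_const)
  obtain ⟨r, hr, hmem⟩ := exists_memLp_exp_mul_norm
    (fun s => schrodinger_modulation_coeFn (EuclideanSpace.single j (1 : ℝ)) s ψ) hanalytic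
  refine ⟨r * |lam|, mul_pos hr (abs_pos.2 hlam), ?_⟩
  simpa [EuclideanSpace.inner_single_left, mul_assoc] using hmem

theorem analyticAt_fourierAut (p : H n) : AnalyticAt ℝ (fourierAut lam : H n → H n) p := by
  let L : H n →ₗ[ℝ] H n :=
    { toFun := fourierAut lam
      map_add' := fun p q => by simp [fourierAut, add_comm]
      map_smul' := fun c p => by simp [fourierAut, smul_comm c] }
  exact (LinearMap.toContinuousLinearMap L).analyticAt p

theorem fourier_mem_analyticVectors (hlam : lam ≠ 0) {ψ : V n} (h : ψ ∈ analyticVectors n lam) :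
    (𝓕 ψ : V n) ∈ analyticVectors n lam := by
  intro p _
  have horbit : (fun p : H n => schrodinger lam p (𝓕 ψ)) = fun p =>
      ((Lp.fourierTransformₗᵢ (E n) ℂ).toContinuousLinearEquiv : V n →L[ℂ] V n).restrictScalars ℝ
        (schrodinger lam (fourierAut lam (fourierAut lam (fourierAut lam p))) ψ) := by
    funext p
    conv_lhs => rw [← fourierAut_four hlam p]
    exact (fourier_schrodinger hlam _ ψ).symm
  rw [horbit]
  exact (ContinuousLinearMap.analyticAt _ _).fun_comp ((h _ (Set.mem_univ _)).fun_comp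
    ((analyticAt_fourierAut _).fun_comp
      ((analyticAt_fourierAut _).fun_comp (analyticAt_fourierAut p))))

theorem exists_decayPair_of_mem_analyticVectors (hlam : lam ≠ 0) {ψ : V n}
    (h : ψ ∈ analyticVectors n lam) : ∃ ψ₀ : E n → ℂ, DecayPair ψ₀ ∧ ψ =ᵐ[volume] ψ₀ :=
  exists_decayPair ψ (expWeighted_of_mem_analyticVectors hlam h)
    (expWeighted_of_mem_analyticVectors hlam (fourier_mem_analyticVectors hlam h))

end AnalyticVector

/-! ### Coherent states -/

section Gaussian

variable {F : Type*} [NormedAddCommGroup F]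

/-- The Gaussian `e^{-π|ξ|²}`, which is its own Fourier transform. -/
def gauss (ξ : F) : ℂ := Complex.exp (-(π : ℂ) * (‖ξ‖ : ℂ) ^ 2)

theorem continuous_gauss : Continuous (gauss : F → ℂ) := by unfold gauss; fun_prop

theorem gauss_eq_ofReal (ξ : F) : gauss ξ = ((Real.exp (-π * ‖ξ‖ ^ 2) : ℝ) : ℂ) := by
  simp [gauss]

theorem conj_gauss (ξ : F) : starRingEnd ℂ (gauss ξ) = gauss ξ := by
  rw [gauss_eq_ofReal, Complex.conj_ofReal]

theorem norm_gauss_le (a : ℝ) (ξ : F) :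
    ‖gauss ξ‖ ≤ Real.exp (a ^ 2) * Real.exp (-a * ‖ξ‖) := by
  rw [gauss_eq_ofReal, Complex.norm_real, Real.norm_of_nonneg (Real.exp_pos _).le, ← Real.exp_add]
  refine Real.exp_le_exp.2 ?_
  nlinarith [Real.pi_gt_three, sq_nonneg (a - ‖ξ‖), sq_nonneg ‖ξ‖, sq_nonneg a]

theorem expDecay_gauss : ExpDecay (gauss : F → ℂ) :=
  ⟨1, one_pos, _, norm_gauss_le 1⟩

variable [InnerProductSpace ℝ F] [FiniteDimensional ℝ F] [MeasurableSpace F] [BorelSpace F]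

theorem fourier_gauss : 𝓕 (gauss : F → ℂ) = gauss := by
  funext w
  have hpi : (π : ℂ) ≠ 0 := by exact_mod_cast Real.pi_ne_zero
  rw [gauss]
  refine (fourier_gaussian_innerProductSpace (b := (π : ℂ)) (by simpa using Real.pi_pos) w).trans ?_
  rw [div_self hpi, Complex.one_cpow, one_mul]
  congr 1
  field_simp

theorem decayPair_gauss : DecayPair (gauss : F → ℂ) where
  continuous := continuous_gauss
  decay := expDecay_gauss
  decay_fourier := by rw [fourier_gauss]; exact expDecay_gauss

theorem integral_gauss_mul_self_ne_zero : ∫ η : F, gauss η * gauss η ≠ 0 := by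
  have hpi : (π : ℂ) ≠ 0 := by exact_mod_cast Real.pi_ne_zero
  have hsq (η : F) : gauss η * gauss η = Complex.exp (-(2 * π : ℂ) * (‖η‖ : ℂ) ^ 2) := by
    rw [gauss, ← Complex.exp_add]
    congr 1
    ring
  simp only [hsq]
  rw [GaussianFourier.integral_cexp_neg_mul_sq_norm (by simpa using Real.pi_pos),
    Complex.cpow_def_of_ne_zero (div_ne_zero hpi (by simp))]
  exact Complex.exp_ne_zero _

/-- The element of `L²` represented by a function that decays with its Fourier transform. -/
def DecayPair.toL2 {ψ : F → ℂ} (h : DecayPair ψ) : Lp (α := F) ℂ 2 volume := h.memLp.toLp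

theorem DecayPair.coeFn_toL2 {ψ : F → ℂ} (h : DecayPair ψ) : h.toL2 =ᵐ[volume] ψ :=
  h.memLp.coeFn_toLp

theorem DecayPair.fourier_toL2 {ψ : F → ℂ} (h : DecayPair ψ) :
    (𝓕 h.toL2 : Lp (α := F) ℂ 2 volume) = h.fourier.toL2 := by
  have hi : Integrable h.toL2 := (integrable_congr h.coeFn_toL2).2 h.integrable
  exact Lp.ext ((fourier_coeFn _ hi).trans
    ((Filter.EventuallyEq.of_eq (funext fun w => Real.fourier_congr_ae h.coeFn_toL2 w)).trans
      h.fourier.coeFn_toL2.symm))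

variable (F) in
/-- The Gaussian as an element of `L²`. -/
def gaussL2 : Lp (α := F) ℂ 2 volume := (decayPair_gauss (F := F)).toL2

theorem gaussL2_coeFn : gaussL2 F =ᵐ[volume] gauss := decayPair_gauss.coeFn_toL2

theorem fourier_gaussL2 : (𝓕 (gaussL2 F) : Lp (α := F) ℂ 2 volume) = gaussL2 F := by
  refine Lp.ext ?_
  rw [gaussL2, decayPair_gauss.fourier_toL2]
  refine decayPair_gauss.fourier.coeFn_toL2.trans ?_
  rw [fourier_gauss]
  exact gaussL2_coeFn.symm

theorem fourier_inversion_smul {G : F → ℂ} (hc : Continuous G) (hi : Integrable G)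
    (hi' : Integrable (𝓕 G)) {R : ℝ} (hR : R ≠ 0) (m : F) :
    ((|R ^ Module.finrank ℝ F| : ℝ) : ℂ) * ∫ x,
      Complex.exp (((2 * π * inner ℝ (R • x) m : ℝ) : ℂ) * Complex.I) * 𝓕 G (R • x) = G m := by
  have hinv := congrFun (hc.fourierInv_fourier_eq hi hi') m
  rw [Real.fourierInv_eq'] at hinv
  have hcomp := Measure.integral_comp_smul (volume : Measure F) (fun y : F =>
    Complex.exp (((2 * π * inner ℝ y m : ℝ) : ℂ) * Complex.I) • 𝓕 G y) R
  rw [hinv, Complex.real_smul] at hcomp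
  simp only [smul_eq_mul] at hcomp
  rw [hcomp, ← mul_assoc, ← Complex.ofReal_mul, ← abs_mul, mul_inv_cancel₀ (pow_ne_zero _ hR)]
  simp

end Gaussian

section RankOneKern

variable {F : Type*} [NormedAddCommGroup F] [InnerProductSpace ℝ F] {ψ : F → ℂ}

/-- The integral kernel of the rank one operator `⟨gauss, ·⟩ ψ`, in the midpoint and difference
coordinates of `kern`. -/
def rankOneKern (ψ : F → ℂ) (m u : F) : ℂ :=
  ψ (m - (1 / 2 : ℝ) • u) * gauss (m + (1 / 2 : ℝ) • u)

theorem rankOneKern_add_half (ψ : F → ℂ) (ξ u : F) :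
    rankOneKern ψ (ξ + (1 / 2 : ℝ) • u) u = ψ ξ * gauss (ξ + u) := by
  rw [rankOneKern, add_sub_cancel_right, add_assoc, ← add_smul]
  norm_num

theorem continuous_rankOneKern (hψ : Continuous ψ) (u : F) : Continuous (rankOneKern ψ · u) :=
  (hψ.comp (by fun_prop)).mul (continuous_gauss.comp (by fun_prop))

theorem norm_add_norm_le_sub_half_add_half (m u : F) :
    ‖m‖ + ‖u‖ ≤ 2 * (‖m - (1 / 2 : ℝ) • u‖ + ‖m + (1 / 2 : ℝ) • u‖) := by
  have hu := norm_sub_le (m + (1 / 2 : ℝ) • u) (m - (1 / 2 : ℝ) • u)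
  have hm := norm_add_le (m - (1 / 2 : ℝ) • u) (m + (1 / 2 : ℝ) • u)
  rw [show m + (1 / 2 : ℝ) • u - (m - (1 / 2 : ℝ) • u) = u by module] at hu
  rw [show m - (1 / 2 : ℝ) • u + (m + (1 / 2 : ℝ) • u) = (2 : ℝ) • m by module, norm_smul,
    Real.norm_two] at hm
  linarith [norm_nonneg m]

theorem exists_norm_rankOneKern_le (h : ExpDecay ψ) :
    ∃ t : ℝ, 0 < t ∧ ∃ C : ℝ, 0 ≤ C ∧ ∀ m u : F,
      ‖rankOneKern ψ m u‖ ≤ C * Real.exp (-t * (‖m‖ + ‖u‖)) := by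
  obtain ⟨t, ht, C, hC⟩ := h
  refine ⟨t / 2, by positivity, |C| * Real.exp (t ^ 2), by positivity, fun m u => ?_⟩
  calc ‖rankOneKern ψ m u‖
      ≤ |C| * Real.exp (-t * ‖m - (1 / 2 : ℝ) • u‖) *
        (Real.exp (t ^ 2) * Real.exp (-t * ‖m + (1 / 2 : ℝ) • u‖)) := by
        rw [rankOneKern, norm_mul]
        gcongr
        · exact (hC _).trans (mul_le_mul_of_nonneg_right (le_abs_self C) (Real.exp_pos _).le)
        · exact norm_gauss_le t _
    _ = |C| * Real.exp (t ^ 2) *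
        Real.exp (-t * (‖m - (1 / 2 : ℝ) • u‖ + ‖m + (1 / 2 : ℝ) • u‖)) := by
        rw [mul_add, Real.exp_add]
        ring
    _ ≤ _ := by
        gcongr ?_ * Real.exp ?_
        nlinarith [norm_add_norm_le_sub_half_add_half m u]

end RankOneKern

section Coherent

variable {n : ℕ} {lam : ℝ} {ψ : E n → ℂ}

/-- The matrix coefficient `⟨π_lam(x,u,0) gauss, ψ⟩`, see `coeff_eq_inner`. -/
def coeff (lam : ℝ) (ψ : E n → ℂ) (x u : E n) : ℂ :=
  𝓕 (rankOneKern ψ · u) ((lam / (2 * π)) • x)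

theorem coeff_eq_inner (h : DecayPair ψ) (x u : E n) :
    coeff lam ψ x u = inner ℂ (schrodinger lam (x, u, 0) (gaussL2 (E n))) h.toL2 := by
  have hpi : (π : ℂ) ≠ 0 := by exact_mod_cast Real.pi_ne_zero
  have hinner : inner ℂ (schrodinger lam (x, u, 0) (gaussL2 (E n))) h.toL2 =
      ∫ ξ, starRingEnd ℂ (schrodingerFun lam (x, u, 0) gauss ξ) * ψ ξ := by
    rw [L2.inner_def]
    refine integral_congr_ae ?_
    filter_upwards [schrodinger_coeFn lam (x, u, 0) (gaussL2 (E n)),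
      schrodingerFun_congr lam (x, u, 0) gaussL2_coeFn, h.coeFn_toL2] with ξ h1 h2 h3
    rw [h1, h2, h3, RCLike.inner_apply']
  rw [hinner, coeff, Real.fourier_eq', ← integral_sub_right_eq_self
    (fun ξ => starRingEnd ℂ (schrodingerFun lam (x, u, 0) gauss ξ) * ψ ξ) ((1 / 2 : ℝ) • u)]
  refine integral_congr_ae (.of_forall fun m => ?_)
  have hshift : m - (1 / 2 : ℝ) • u + u = m + (1 / 2 : ℝ) • u := by module
  simp only [rankOneKern, schrodingerFun, map_mul, hshift, conj_gauss, smul_eq_mul, mul_zero,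
    Complex.ofReal_zero, Complex.exp_zero, one_mul, ← Complex.exp_conj, Complex.conj_I,
    Complex.conj_ofReal]
  rw [mul_comm (ψ _), ← mul_assoc]
  congr 3
  simp only [inner_sub_right, real_inner_smul_right]
  rw [real_inner_comm m x]
  push_cast
  field_simp
  ring

theorem coeff_eq_coeff_fourier (hlam : lam ≠ 0) (h : DecayPair ψ) (x u : E n) :
    coeff lam ψ x u =
      coeff lam (𝓕 ψ) ((2 * π / lam) • u) (-((lam / (2 * π)) • x)) := by
  rw [coeff_eq_inner h, coeff_eq_inner h.fourier, ← h.fourier_toL2,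
    ← Lp.inner_fourier_eq, fourier_schrodinger hlam, fourier_gaussL2]
  rfl

theorem continuous_coeff (hlam : lam ≠ 0) (h : DecayPair ψ) :
    Continuous fun p : H n => coeff lam ψ p.1 p.2.1 := by
  simp only [coeff_eq_inner h]
  exact ((continuous_schrodinger hlam (gaussL2 (E n))).comp
    (f := fun p : H n => ((p.1, p.2.1, 0) : H n)) (by fun_prop)).inner continuous_const

theorem exists_norm_coeff_le_exp_snd (lam : ℝ) (h : ExpDecay ψ) :
    ∃ t : ℝ, 0 < t ∧ ∃ C : ℝ, 0 ≤ C ∧ ∀ x u : E n,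
      ‖coeff lam ψ x u‖ ≤ C * Real.exp (-t * ‖u‖) := by
  obtain ⟨t, ht, C, hC, hb⟩ := exists_norm_rankOneKern_le h
  refine ⟨t, ht, C * ∫ m : E n, Real.exp (-t * ‖m‖), by positivity, fun x u =>
    (norm_fourier_le _ _).trans ?_⟩
  calc ∫ m, ‖rankOneKern ψ m u‖
      ≤ ∫ m : E n, (C * Real.exp (-t * ‖u‖)) * Real.exp (-t * ‖m‖) := by
        refine integral_mono_of_nonneg (.of_forall fun _ => norm_nonneg _)
          ((integrable_exp_neg_mul_norm ht).const_mul _)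
          (.of_forall fun m => (hb m u).trans_eq ?_)
        simp only [mul_add, Real.exp_add]
        ring
    _ = _ := by rw [integral_const_mul]; ring

theorem exists_norm_coeff_le (hlam : lam ≠ 0) (h : DecayPair ψ) :
    ∃ t : ℝ, 0 < t ∧ ∃ C : ℝ, 0 ≤ C ∧ ∀ x u : E n,
      ‖coeff lam ψ x u‖ ≤ C * Real.exp (-t * (‖x‖ + ‖u‖)) := by
  obtain ⟨t, ht, C, hC, h1⟩ := exists_norm_coeff_le_exp_snd lam h.decay
  obtain ⟨s, hs, D, -, h2⟩ := exists_norm_coeff_le_exp_snd lam h.decay_fourier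
  set k := |lam / (2 * π)| with hk
  have hmin : 0 < min t (s * k) := lt_min ht (mul_pos hs (by positivity))
  refine ⟨min t (s * k) / 2, by positivity, max C D, hC.trans (le_max_left _ _), fun x u => ?_⟩
  rcases le_total ‖x‖ ‖u‖ with hxu | hxu
  · refine (h1 x u).trans ?_
    gcongr ?_ * Real.exp ?_
    · exact le_max_left _ _
    · nlinarith [mul_le_mul_of_nonneg_right (min_le_left t (s * k)) (norm_nonneg u)]
  · rw [coeff_eq_coeff_fourier hlam h]
    refine (h2 _ _).trans ?_
    rw [norm_neg, norm_smul, Real.norm_eq_abs, ← hk]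
    gcongr ?_ * Real.exp ?_
    · exact le_max_right _ _
    · nlinarith [mul_le_mul_of_nonneg_right (min_le_right t (s * k)) (norm_nonneg x)]

theorem DecayPair.integrable_rankOneKern (h : DecayPair ψ) (u : E n) :
    Integrable (rankOneKern ψ · u) := by
  obtain ⟨t, ht, C, hC, hb⟩ := exists_norm_rankOneKern_le h.decay
  refine ExpDecay.integrable ⟨t, ht, C, fun m => (hb m u).trans ?_⟩
    (continuous_rankOneKern h.continuous u).aestronglyMeasurable
  gcongr ?_ * Real.exp ?_
  nlinarith [norm_nonneg u]

theorem DecayPair.integrable_fourier_rankOneKern (h : DecayPair ψ) (u : E n) :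
    Integrable (𝓕 (rankOneKern ψ · u)) := by
  have hpi : 2 * π ≠ 0 := by positivity
  obtain ⟨t, ht, C, hC, hb⟩ := exists_norm_coeff_le hpi h
  refine ExpDecay.integrable ⟨t, ht, C, fun y => ?_⟩
    (continuous_fourier (h.integrable_rankOneKern u)).aestronglyMeasurable
  have hy := hb y u
  rw [coeff, div_self hpi, one_smul] at hy
  refine hy.trans ?_
  gcongr ?_ * Real.exp ?_
  nlinarith [norm_nonneg u]

/-- A Gaussian on the centre, normalized so that its integral against `e^{i lam t}` is `1`. -/
def centralGauss (lam t : ℝ) : ℂ :=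
  Complex.exp ((lam : ℂ) ^ 2 / (4 * π)) * Complex.exp (-(π : ℂ) * (t : ℂ) ^ 2)

theorem integral_centralGauss :
    ∫ t : ℝ, centralGauss lam t * Complex.exp (Complex.I * ((lam * t : ℝ) : ℂ)) = 1 := by
  have hpi : (π : ℂ) ≠ 0 := by exact_mod_cast Real.pi_ne_zero
  have h := fourierIntegral_gaussian (b := (π : ℂ)) (by simpa using Real.pi_pos) (lam : ℂ)
  rw [div_self hpi, Complex.one_cpow, one_mul] at h
  calc _ = ∫ t : ℝ, Complex.exp ((lam : ℂ) ^ 2 / (4 * π)) *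
        (Complex.exp (Complex.I * lam * t) * Complex.exp (-(π : ℂ) * (t : ℂ) ^ 2)) := by
        refine integral_congr_ae (.of_forall fun t => ?_)
        simp only [centralGauss]
        push_cast
        rw [mul_assoc Complex.I]
        ring
    _ = 1 := by
        rw [integral_const_mul, h, ← Complex.exp_add, neg_div, add_neg_cancel, Complex.exp_zero]

theorem integrable_centralGauss : Integrable (centralGauss lam) :=
  (integrable_cexp_neg_mul_sq (by simpa using Real.pi_pos)).const_mul _

/-- The function on `ℍⁿ` whose operator under `π_lam` is the rank one operator `⟨gauss, ·⟩ ψ`. The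
factor `|lam / 2π|ⁿ` comes from Fourier inversion. -/
def coherent (lam : ℝ) (ψ : E n → ℂ) (p : H n) : ℂ :=
  ((|(lam / (2 * π)) ^ n| : ℝ) : ℂ) * (centralGauss lam p.2.2 * coeff lam ψ p.1 p.2.1)

theorem continuous_coherent (hlam : lam ≠ 0) (h : DecayPair ψ) : Continuous (coherent lam ψ) := by
  refine continuous_const.mul (Continuous.mul ?_ (continuous_coeff hlam h))
  unfold centralGauss
  fun_prop

theorem exists_integrable_exp_mul_coherent (hlam : lam ≠ 0) (h : DecayPair ψ) :
    ∃ r : ℝ, 0 < r ∧ Integrable fun p : H n =>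
      Real.exp (r * (‖p.1‖ + ‖p.2.1‖)) * ‖coherent lam ψ p‖ := by
  obtain ⟨t, ht, C, -, hb⟩ := exists_norm_coeff_le hlam h
  have hexp := integrable_exp_neg_mul_norm (F := E n) (μ := volume) (half_pos ht)
  have hprod : Integrable fun p : H n => Real.exp (-(t / 2) * ‖p.1‖) *
      (Real.exp (-(t / 2) * ‖p.2.1‖) * ‖centralGauss lam p.2.2‖) :=
    hexp.mul_prod (hexp.mul_prod integrable_centralGauss.norm)
  set c := |(lam / (2 * π)) ^ n|
  refine ⟨t / 2, by positivity, (hprod.const_mul (c * C)).mono' ?_ (.of_forall fun p => ?_)⟩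
  · exact (Continuous.mul (by fun_prop) (continuous_coherent hlam h).norm).aestronglyMeasurable
  rw [Real.norm_of_nonneg (by positivity), coherent, norm_mul, norm_mul, Complex.norm_real,
    Real.norm_of_nonneg (abs_nonneg _)]
  have hhalf : Real.exp (t / 2 * (‖p.1‖ + ‖p.2.1‖)) * Real.exp (-t * (‖p.1‖ + ‖p.2.1‖)) =
      Real.exp (-(t / 2) * ‖p.1‖) * Real.exp (-(t / 2) * ‖p.2.1‖) := by
    rw [← Real.exp_add, ← Real.exp_add]
    congr 1
    ring
  calc _ ≤ Real.exp (t / 2 * (‖p.1‖ + ‖p.2.1‖)) *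
        (c * (‖centralGauss lam p.2.2‖ * (C * Real.exp (-t * (‖p.1‖ + ‖p.2.1‖))))) := by
        gcongr
        exact hb _ _
    _ = _ := by linear_combination c * C * ‖centralGauss lam p.2.2‖ * hhalf

theorem integrable_coherent (hlam : lam ≠ 0) (h : DecayPair ψ) : Integrable (coherent lam ψ) := by
  obtain ⟨r, hr, hi⟩ := exists_integrable_exp_mul_coherent hlam h
  refine hi.mono' (continuous_coherent hlam h).aestronglyMeasurable (.of_forall fun p => ?_)
  exact le_mul_of_one_le_left (norm_nonneg _) (Real.one_le_exp (by positivity))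

theorem centralFourier_coherent (x u : E n) : centralFourier lam (coherent lam ψ) x u =
    ((|(lam / (2 * π)) ^ n| : ℝ) : ℂ) * coeff lam ψ x u := by
  have hfactor (t : ℝ) :
      coherent lam ψ (x, u, t) * Complex.exp (Complex.I * ((lam * t : ℝ) : ℂ)) =
        ((|(lam / (2 * π)) ^ n| : ℝ) : ℂ) * coeff lam ψ x u *
          (centralGauss lam t * Complex.exp (Complex.I * ((lam * t : ℝ) : ℂ))) := by
    simp only [coherent]
    ring
  simp only [centralFourier, hfactor]
  rw [integral_const_mul, integral_centralGauss, mul_one]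

theorem kern_coherent (hlam : lam ≠ 0) (h : DecayPair ψ) (m u : E n) :
    kern lam (coherent lam ψ) m u = rankOneKern ψ m u := by
  have hR : lam / (2 * π) ≠ 0 := by positivity
  rw [← fourier_inversion_smul (continuous_rankOneKern h.continuous u) (h.integrable_rankOneKern u)
    (h.integrable_fourier_rankOneKern u) hR m, finrank_euclideanSpace_fin, kern,
    ← integral_const_mul]
  refine integral_congr_ae (.of_forall fun x => ?_)
  have hphase : lam * inner ℝ m x = 2 * π * inner ℝ ((lam / (2 * π)) • x) m := by
    rw [real_inner_smul_left, real_inner_comm]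
    field_simp
  simp only [centralFourier_coherent, coeff, hphase]
  rw [mul_comm Complex.I]
  ring

theorem kernDecay_coherent (hlam : lam ≠ 0) (h : DecayPair ψ) :
    KernDecay lam (coherent lam ψ) := by
  obtain ⟨t, ht, C, -, hb⟩ := exists_norm_rankOneKern_le h.decay
  exact ⟨t, ht, C, .of_forall fun z => (congrArg norm (kern_coherent hlam h _ _)).trans_le (hb _ _)⟩

theorem coherent_comp_fourierAut (hlam : lam ≠ 0) (h : DecayPair ψ) :
    coherent lam ψ ∘ fourierAut lam = coherent lam (𝓕⁻ ψ) := by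
  funext p
  have hcoeff := coeff_eq_coeff_fourier hlam h.fourierInv p.1 p.2.1
  rw [h.continuous.fourier_fourierInv_eq h.integrable h.integrable_fourier] at hcoeff
  simp only [Function.comp_apply, coherent, fourierAut, hcoeff]

theorem coherent_mem_B (hlam : lam ≠ 0) (h : DecayPair ψ) :
    (integrable_coherent hlam h).toL1 (coherent lam ψ) ∈ B n lam := by
  have hcoe := (integrable_coherent hlam h).coeFn_toL1
  refine (mem_B_iff hlam _).2 ⟨(kernDecay_coherent hlam h).congr hcoe.symm, ?_⟩
  refine KernDecay.congr (f := coherent lam ψ ∘ fourierAut lam) ?_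
    ((measurePreserving_fourierAut hlam).quasiMeasurePreserving.ae hcoe.symm)
  rw [coherent_comp_fourierAut hlam h]
  exact kernDecay_coherent hlam h.fourierInv

theorem integral_coherent_smul_schrodinger_gaussL2 (hlam : lam ≠ 0) (h : DecayPair ψ) :
    ∫ p, coherent lam ψ p • schrodinger lam p (gaussL2 (E n)) =
      (∫ η : E n, gauss η * gauss η) • h.toL2 := by
  refine ext_inner_left ℂ fun g => ?_
  rw [inner_integral_smul_schrodinger hlam (integrable_coherent hlam h), inner_smul_right,
    L2.inner_def, ← integral_const_mul]
  refine integral_congr_ae ?_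
  filter_upwards [h.coeFn_toL2] with ξ hξ
  have hkern : ∀ᵐ u, starRingEnd ℂ (g ξ) * (kern lam (coherent lam ψ) (ξ + (1 / 2 : ℝ) • u) u *
      gaussL2 (E n) (ξ + u)) = starRingEnd ℂ (g ξ) * ψ ξ * (gauss (ξ + u) * gauss (ξ + u)) := by
    filter_upwards [(measurePreserving_add_left volume ξ).quasiMeasurePreserving.ae
      gaussL2_coeFn] with u hu
    rw [kern_coherent hlam h, rankOneKern_add_half, hu]
    ring
  rw [hξ, RCLike.inner_apply', integral_congr_ae hkern, integral_const_mul,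
    integral_add_left_eq_self (fun η => gauss η * gauss η) ξ]
  ring

theorem DecayPair.toL2_eq_integral (hlam : lam ≠ 0) (h : DecayPair ψ) :
    h.toL2 = ∫ p, coherent lam ψ p • schrodinger lam p
      ((∫ η : E n, gauss η * gauss η)⁻¹ • gaussL2 (E n)) := by
  simp only [← schrodingerₗᵢ_apply, map_smul]
  simp only [schrodingerₗᵢ_apply, smul_comm (coherent lam ψ _)]
  rw [integral_smul, integral_coherent_smul_schrodinger_gaussL2 hlam h, smul_smul,
    inv_mul_cancel₀ integral_gauss_mul_self_ne_zero, one_smul]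

end Coherent

/-! ### Analyticity of orbits -/

section Orbit

variable {n : ℕ} {lam : ℝ}

theorem analyticAt_mul (p q : H n) : AnalyticAt ℝ (mul p) q := by
  refine contDiff_omega_iff_analyticOnNhd.1 ?_ q (Set.mem_univ q)
  refine (contDiff_const.add contDiff_fst).prodMk (ContDiff.prodMk (by fun_prop)
    (ContDiff.add (by fun_prop) (contDiff_const.mul ?_)))
  exact (contDiff_const.inner ℝ contDiff_fst).sub
    (ContDiff.inner ℝ (by fun_prop) contDiff_const)

theorem mul_mul_inv_cancel (p q : H n) : mul p (mul (inv p) q) = q := by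
  ext : 2
  · simp [mul, inv]
  · simp [mul, inv]
  · simp only [mul, inv, inner_add_left, inner_add_right, inner_neg_left, inner_neg_right]
    ring

theorem inv_mul_self (p : H n) : mul (inv p) p = 0 := by
  ext : 2 <;> simp [mul, inv, real_inner_comm]

theorem mem_analyticVectors_of_analyticAt_zero {ψ : V n}
    (h : AnalyticAt ℝ (fun p : H n => schrodinger lam p ψ) 0) : ψ ∈ analyticVectors n lam := by
  intro p _
  have translate : (fun q : H n => schrodinger lam q ψ) = fun q =>
      (schrodingerₗᵢ lam p).toContinuousLinearMap.restrictScalars ℝ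
        (schrodinger lam (mul (inv p) q) ψ) := by
    funext q
    change _ = schrodinger lam p _
    rw [schrodinger_mul, mul_mul_inv_cancel]
  rw [translate]
  rw [← inv_mul_self p] at h
  exact (ContinuousLinearMap.analyticAt _ _).fun_comp (h.fun_comp (analyticAt_mul (inv p) p))

/-- The real linear form `(y,v,s) ↦ α a·y + β b·v`. -/
def horizontalForm (α β : ℂ) (a b : E n) : H n →L[ℝ] ℂ :=
  ((innerSL ℝ a).comp (.fst ℝ _ _)).smulRight α +
    ((innerSL ℝ b).comp ((ContinuousLinearMap.fst ℝ _ _).comp (.snd ℝ _ _))).smulRight β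

theorem horizontalForm_apply (α β : ℂ) (a b : E n) (q : H n) :
    horizontalForm α β a b q = (inner ℝ a q.1 : ℂ) * α + (inner ℝ b q.2.1 : ℂ) * β := by
  simp [horizontalForm]

theorem norm_horizontalForm_le (α β : ℂ) (a b : E n) :
    ‖horizontalForm α β a b‖ ≤ ‖α‖ * ‖a‖ + ‖β‖ * ‖b‖ := by
  refine ContinuousLinearMap.opNorm_le_bound _ (by positivity) fun q => ?_
  have hy : ‖q.1‖ ≤ ‖q‖ := norm_fst_le q
  have hv : ‖q.2.1‖ ≤ ‖q‖ := (norm_fst_le q.2).trans (norm_snd_le q)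
  rw [horizontalForm_apply]
  calc _ ≤ ‖a‖ * ‖q.1‖ * ‖α‖ + ‖b‖ * ‖q.2.1‖ * ‖β‖ := by
        refine (norm_add_le _ _).trans ?_
        rw [norm_mul, norm_mul, Complex.norm_real, Complex.norm_real]
        gcongr <;> exact norm_inner_le_norm _ _
    _ ≤ ‖a‖ * ‖q‖ * ‖α‖ + ‖b‖ * ‖q‖ * ‖β‖ := by gcongr
    _ = _ := by ring

section Gaussian

theorem memLp_two_exp_mul_norm_mul_norm_gauss (a : ℝ) :
    MemLp (fun ξ : E n => Real.exp (a * ‖ξ‖) * ‖gauss ξ‖) 2 volume := by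
  refine (memLp_two_exp_neg_mul_norm (t := 1) one_pos).of_le_mul (c := Real.exp ((a + 1) ^ 2))
    (Continuous.mul (by fun_prop) continuous_gauss.norm).aestronglyMeasurable
    (.of_forall fun ξ => ?_)
  rw [Real.norm_of_nonneg (by positivity), Real.norm_of_nonneg (by positivity)]
  calc _ ≤ Real.exp (a * ‖ξ‖) * (Real.exp ((a + 1) ^ 2) * Real.exp (-(a + 1) * ‖ξ‖)) := by
        gcongr; exact norm_gauss_le (a + 1) ξ
    _ = _ := by
        simp only [← Real.exp_add]
        congr 1
        ring

/-- The scalar factor in the orbit of the Gaussian, see `schrodingerFun_gauss`. -/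
def gaussFactor (lam : ℝ) (q : H n) : ℂ :=
  Complex.exp (Complex.I * ((lam * (q.2.2 + 1 / 2 * inner ℝ q.1 q.2.1) : ℝ) : ℂ) -
    ((π * inner ℝ q.2.1 q.2.1 : ℝ) : ℂ))

theorem gaussFactor_ne_zero (q : H n) : gaussFactor lam q ≠ 0 := Complex.exp_ne_zero _

theorem analyticAt_gaussFactor (q : H n) : AnalyticAt ℝ (gaussFactor lam : H n → ℂ) q := by
  refine contDiff_omega_iff_analyticOnNhd.1 ?_ q (Set.mem_univ q)
  have hxu : ContDiff ℝ ⊤ fun q : H n => (inner ℝ q.1 q.2.1 : ℝ) :=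
    .inner ℝ (by fun_prop) (by fun_prop)
  have huu : ContDiff ℝ ⊤ fun q : H n => (inner ℝ q.2.1 q.2.1 : ℝ) :=
    .inner ℝ (by fun_prop) (by fun_prop)
  exact ((contDiff_const.mul (Complex.ofRealCLM.contDiff.comp
    (contDiff_const.mul (ContDiff.add (by fun_prop) (contDiff_const.mul hxu))))).sub
    (Complex.ofRealCLM.contDiff.comp (contDiff_const.mul huu))).cexp

theorem schrodingerFun_gauss (q : H n) (ξ : E n) : schrodingerFun lam q gauss ξ =
    gaussFactor lam q *
      (Complex.exp (horizontalForm (Complex.I * lam) (-2 * π) ξ ξ q) * gauss ξ) := by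
  have hsq : (‖ξ + q.2.1‖ : ℂ) ^ 2 =
      ((‖ξ‖ ^ 2 + 2 * inner ℝ ξ q.2.1 + inner ℝ q.2.1 q.2.1 : ℝ) : ℂ) := by
    rw [← Complex.ofReal_pow, norm_add_sq_real, real_inner_self_eq_norm_sq]
  rw [schrodingerFun, gauss, gauss, gaussFactor, horizontalForm_apply, hsq, real_inner_comm ξ q.1]
  simp only [← Complex.exp_add]
  congr 1
  push_cast
  ring

theorem analyticAt_schrodinger_gaussL2 :
    AnalyticAt ℝ (fun q : H n => schrodinger lam q (gaussL2 (E n))) 0 := by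
  have exponential : AnalyticAt ℝ (fun q : H n =>
      (gaussFactor lam q)⁻¹ • schrodinger lam q (gaussL2 (E n))) 0 := by
    refine analyticAt_expMultiplier
      (L := fun ξ => horizontalForm (Complex.I * lam) (-2 * π) ξ ξ)
      (N := fun ξ => ‖Complex.I * lam‖ * ‖ξ‖ + ‖(-2 * π : ℂ)‖ * ‖ξ‖) (fun q => ?_)
      (fun ξ => norm_horizontalForm_le _ _ ξ ξ) continuous_gauss.aestronglyMeasurable one_pos
      ?_ fun q _ => ?_
    · simp only [horizontalForm_apply]
      exact Continuous.aestronglyMeasurable (by fun_prop)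
    · simp only [one_mul, ← add_mul]
      exact memLp_two_exp_mul_norm_mul_norm_gauss _
    · filter_upwards [Lp.coeFn_smul (gaussFactor lam q)⁻¹ (schrodinger lam q (gaussL2 (E n))),
        schrodinger_coeFn lam q (gaussL2 (E n)), schrodingerFun_congr lam q gaussL2_coeFn]
        with ξ hsmul hcoe hgauss
      rw [hsmul, Pi.smul_apply, hcoe, hgauss, schrodingerFun_gauss, smul_eq_mul,
        inv_mul_cancel_left₀ (gaussFactor_ne_zero q)]
  refine ((analyticAt_gaussFactor (lam := lam) 0).smul exponential).congr (.of_forall fun q => ?_)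
  exact smul_inv_smul₀ (gaussFactor_ne_zero q) _

end Gaussian

section Integral

theorem schrodinger_comm (p q : H n) (φ : V n) :
    schrodinger lam q (schrodinger lam p φ) =
      Complex.exp (horizontalForm (-(Complex.I * lam)) (Complex.I * lam) p.2.1 p.1 q) •
        schrodinger lam p (schrodinger lam q φ) := by
  have hform : horizontalForm (-(Complex.I * lam)) (Complex.I * lam) p.2.1 p.1 q =
      Complex.I * ((lam * (inner ℝ q.2.1 p.1 - inner ℝ p.2.1 q.1) : ℝ) : ℂ) := by
    rw [horizontalForm_apply, real_inner_comm p.1]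
    push_cast
    ring
  rw [hform, ← schrodinger_central, schrodinger_mul, schrodinger_mul, schrodinger_mul]
  congr 1
  ext : 2
  · simp [mul, add_comm]
  · simp [mul, add_comm]
  · simp only [mul, inner_zero_left, inner_zero_right, zero_add]
    ring

theorem norm_cexp_commutator (p q : H n) :
    ‖Complex.exp (horizontalForm (-(Complex.I * lam)) (Complex.I * lam) p.2.1 p.1 q)‖ = 1 := by
  rw [Complex.norm_exp, horizontalForm_apply]
  simp

theorem aestronglyMeasurable_commutator (q : H n) : AEStronglyMeasurable fun p : H n =>
    horizontalForm (-(Complex.I * lam)) (Complex.I * lam) p.2.1 p.1 q := by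
  simp only [horizontalForm_apply]
  exact Continuous.aestronglyMeasurable (by fun_prop)

theorem integrable_cexp_commutator_mul {f : H n → ℂ} (hf : Integrable f) (lam : ℝ) (q : H n) :
    Integrable fun p : H n => Complex.exp
      (horizontalForm (-(Complex.I * lam)) (Complex.I * lam) p.2.1 p.1 q) * f p :=
  hf.bdd_mul (Complex.continuous_exp.comp_aestronglyMeasurable (aestronglyMeasurable_commutator q))
    (.of_forall fun p => (norm_cexp_commutator p q).le)

theorem analyticAt_toL1_cexp_commutator_mul (hlam : lam ≠ 0) {f : H n → ℂ} (hf : Integrable f)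
    {r : ℝ} (hr : 0 < r)
    (hfr : Integrable fun p : H n => Real.exp (r * (‖p.1‖ + ‖p.2.1‖)) * ‖f p‖) :
    AnalyticAt ℝ (fun q : H n => ((integrable_cexp_commutator_mul hf lam q).toL1 _ : L1 n)) 0 := by
  have hl : 0 < |lam| := abs_pos.2 hlam
  refine analyticAt_expMultiplier
    (L := fun p : H n => horizontalForm (-(Complex.I * lam)) (Complex.I * lam) p.2.1 p.1)
    (N := fun p => |lam| * (‖p.1‖ + ‖p.2.1‖)) aestronglyMeasurable_commutator (fun p => ?_) hf.1
    (div_pos hr hl) ?_ fun q _ => Integrable.coeFn_toL1 _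
  · refine (norm_horizontalForm_le _ _ _ _).trans_eq ?_
    simp only [norm_neg, norm_mul, Complex.norm_I, Complex.norm_real, Real.norm_eq_abs, one_mul]
    ring
  · simpa only [memLp_one_iff_integrable, ← mul_assoc, div_mul_cancel₀ r hl.ne'] using hfr

theorem analyticAt_schrodinger_integral (hlam : lam ≠ 0) {f : H n → ℂ} (hf : Integrable f)
    {r : ℝ} (hr : 0 < r)
    (hfr : Integrable fun p : H n => Real.exp (r * (‖p.1‖ + ‖p.2.1‖)) * ‖f p‖) {φ : V n}
    (hφ : AnalyticAt ℝ (fun q : H n => schrodinger lam q φ) 0) :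
    AnalyticAt ℝ (fun q : H n => schrodinger lam q (∫ p, f p • schrodinger lam p φ)) 0 := by
  have commute : (fun q : H n => schrodinger lam q (∫ p, f p • schrodinger lam p φ)) = fun q =>
      schrodingerIntCLM hlam ((integrable_cexp_commutator_mul hf lam q).toL1 _)
        (schrodinger lam q φ) := by
    funext q
    rw [schrodingerIntCLM_apply, schrodingerInt_toL1]
    refine ((schrodingerₗᵢ lam q).toContinuousLinearMap.integral_comp_comm
      (integrable_smul_schrodinger hlam hf φ)).symm.trans
      (integral_congr_ae (.of_forall fun p => ?_))
    simp only [LinearIsometry.coe_toContinuousLinearMap, map_smul, schrodingerₗᵢ_apply]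
    rw [schrodinger_comm, smul_smul, mul_comm]
  rw [commute]
  have bilinear := (schrodingerIntCLM (n := n) hlam).analyticAt_bilinear
    ((integrable_cexp_commutator_mul hf lam 0).toL1 _, schrodinger lam 0 φ)
  exact (bilinear.restrictScalars (𝕜 := ℝ)).comp₂
    (analyticAt_toL1_cexp_commutator_mul hlam hf hr hfr) hφ

end Integral

theorem DecayPair.toL2_mem_analyticVectors (hlam : lam ≠ 0) {ψ : E n → ℂ} (h : DecayPair ψ) :
    h.toL2 ∈ analyticVectors n lam := by
  obtain ⟨r, hr, hi⟩ := exists_integrable_exp_mul_coherent hlam h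
  refine mem_analyticVectors_of_analyticAt_zero ?_
  rw [h.toL2_eq_integral hlam]
  refine analyticAt_schrodinger_integral hlam (integrable_coherent hlam h) hr hi ?_
  simp only [← schrodingerₗᵢ_apply, map_smul]
  exact (analyticAt_const (v := (∫ η : E n, gauss η * gauss η)⁻¹)).smul
    (analyticAt_schrodinger_gaussL2 (lam := lam))

theorem range_schrodingerInt_eq_analyticVectors (hlam : lam ≠ 0) :
    {ψ : V n | ∃ f ∈ B n lam, ∃ φ : V n, ψ = schrodingerInt lam f φ} = analyticVectors n lam := by
  ext ψ
  constructor
  · rintro ⟨f, hf, φ, rfl⟩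
    obtain ⟨ψ₀, h, e⟩ := exists_decayPair_schrodingerInt hlam hf φ
    rw [Lp.ext (e.trans h.coeFn_toL2.symm)]
    exact h.toL2_mem_analyticVectors hlam
  · intro hψ
    obtain ⟨ψ₀, h, e⟩ := exists_decayPair_of_mem_analyticVectors hlam hψ
    refine ⟨_, coherent_mem_B hlam h,
      (∫ η : E n, gauss η * gauss η)⁻¹ • gaussL2 (E n), ?_⟩
    rw [schrodingerInt_toL1, ← h.toL2_eq_integral hlam]
    exact Lp.ext (e.trans h.coeFn_toL2.symm)

end Orbit

/-! ### Convolution -/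

section Convolution

variable {n : ℕ}

theorem measurePreserving_translate (a b : E n) {l : E n → E n → ℝ}
    (hl : Continuous fun z : E n × E n => l z.1 z.2) :
    MeasurePreserving fun p : H n => (p.1 + a, p.2.1 + b, p.2.2 + l p.1 p.2.1) := by
  have slice (x : E n) : MeasurePreserving fun w : E n × ℝ => (w.1 + b, w.2 + l x w.1) := by
    have : Continuous fun w : E n × ℝ => l x w.1 :=
      hl.comp (f := fun w : E n × ℝ => (x, w.1)) (by fun_prop)
    exact MeasurePreserving.skew_product (f := fun u : E n => u + b)
      (g := fun (u : E n) (t : ℝ) => t + l x u) (measurePreserving_add_right volume b)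
      (Continuous.measurable (by fun_prop))
      (.of_forall fun u => (measurePreserving_add_right volume (l x u)).map_eq)
  have : Continuous fun z : E n × E n × ℝ => l z.1 z.2.1 :=
    hl.comp (f := fun z : E n × E n × ℝ => (z.1, z.2.1)) (by fun_prop)
  exact MeasurePreserving.skew_product (f := fun x : E n => x + a)
    (g := fun (x : E n) (w : E n × ℝ) => (w.1 + b, w.2 + l x w.1))
    (measurePreserving_add_right volume a) (Continuous.measurable (by fun_prop))
    (.of_forall fun x => (slice x).map_eq)

theorem measurePreserving_mul_right (q : H n) : MeasurePreserving fun p : H n => mul p q := by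
  have h := measurePreserving_translate q.1 q.2.1
    (l := fun x u => q.2.2 + (1 / 2) * (inner ℝ u q.1 - inner ℝ q.2.1 x)) (by fun_prop)
  simpa only [mul, add_assoc] using h

theorem measurePreserving_mul_left (p : H n) : MeasurePreserving fun q : H n => mul p q := by
  have h := measurePreserving_translate p.1 p.2.1
    (l := fun y v => p.2.2 + (1 / 2) * (inner ℝ p.2.1 y - inner ℝ v p.1)) (by fun_prop)
  convert h using 2 with q
  simp only [mul, add_comm _ q.1, add_comm _ q.2.1, add_comm p.2.2 q.2.2, add_assoc]

theorem measurePreserving_inv : MeasurePreserving (inv : H n → H n) :=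
  (Measure.measurePreserving_neg volume).prod
    ((Measure.measurePreserving_neg volume).prod (Measure.measurePreserving_neg volume))

theorem quasiMeasurePreserving_mul_inv (p : H n) :
    Measure.QuasiMeasurePreserving fun q : H n => mul p (inv q) :=
  ((measurePreserving_mul_left p).comp measurePreserving_inv).quasiMeasurePreserving

theorem continuous_mul_inv : Continuous fun z : H n × H n => mul z.1 (inv z.2) := by
  unfold mul inv; fun_prop

theorem mul_mul_inv_mul_inv (p q r : H n) :
    mul (mul p (inv q)) (inv (mul r (inv q))) = mul p (inv r) := by
  ext : 2
  · simp [mul, inv]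
  · simp [mul, inv]
  · simp only [mul, inv, inner_add_left, inner_add_right, inner_neg_left, inner_neg_right,
      real_inner_comm]
    ring

theorem mul_mul_inv_cancel_right (p q : H n) : mul (mul p q) (inv q) = p := by
  ext : 2
  · simp [mul, inv]
  · simp [mul, inv]
  · simp only [mul, inv, inner_add_left, inner_add_right, inner_neg_left, inner_neg_right,
      real_inner_comm]
    ring

theorem integral_comp_mul_right (f : H n → ℂ) (q : H n) : ∫ p, f (mul p q) = ∫ p, f p := by
  refine (measurePreserving_mul_right q).integral_comp (Continuous.measurableEmbedding ?_
    (Function.LeftInverse.injective (g := (mul · (inv q)))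
      (mul_mul_inv_cancel_right · q))) f
  unfold mul
  fun_prop

/-- Convolution of functions on `ℍⁿ`, with junk value `0` where the integral diverges. -/
def convF (f g : H n → ℂ) (p : H n) : ℂ := ∫ q, f (mul p (inv q)) * g q

theorem convF_congr {f f' g g' : H n → ℂ} (hf : f =ᵐ[volume] f') (hg : g =ᵐ[volume] g') :
    convF f g = convF f' g' := by
  funext p
  refine integral_congr_ae ?_
  filter_upwards [(quasiMeasurePreserving_mul_inv p).ae hf, hg] with q h1 h2
  rw [h1, h2]

theorem integrable_mul_inv_prod {f g : H n → ℂ} (hf : Integrable f) (hg : Integrable g) :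
    Integrable (fun z : H n × H n => f (mul z.1 (inv z.2)) * g z.2) (volume.prod volume) :=
  (measurePreserving_mul_inv n).integrable_comp_of_integrable (hf.mul_prod hg)

theorem ae_integrable_mul_inv {f g : H n → ℂ} (hf : Integrable f) (hg : Integrable g) :
    ∀ᵐ p, Integrable fun q => f (mul p (inv q)) * g q :=
  (integrable_mul_inv_prod hf hg).prod_right_ae

theorem conv_coeFn (f g : L1 n) : conv f g =ᵐ[volume] convF f g :=
  Integrable.coeFn_toL1 _

theorem add_conv (f g h : L1 n) : conv (f + g) h = conv f h + conv g h := by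
  refine Lp.ext ?_
  filter_upwards [conv_coeFn (f + g) h, conv_coeFn f h, conv_coeFn g h,
    Lp.coeFn_add (conv f h) (conv g h),
    ae_integrable_mul_inv (L1.integrable_coeFn f) (L1.integrable_coeFn h),
    ae_integrable_mul_inv (L1.integrable_coeFn g) (L1.integrable_coeFn h)] with p h1 h2 h3 h4 h5 h6
  rw [h1, h4, Pi.add_apply, h2, h3, convF_congr (Lp.coeFn_add f g) .rfl]
  simp only [convF, Pi.add_apply, add_mul]
  exact integral_add h5 h6

theorem conv_add (f g h : L1 n) : conv f (g + h) = conv f g + conv f h := by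
  refine Lp.ext ?_
  filter_upwards [conv_coeFn f (g + h), conv_coeFn f g, conv_coeFn f h,
    Lp.coeFn_add (conv f g) (conv f h),
    ae_integrable_mul_inv (L1.integrable_coeFn f) (L1.integrable_coeFn g),
    ae_integrable_mul_inv (L1.integrable_coeFn f) (L1.integrable_coeFn h)] with p h1 h2 h3 h4 h5 h6
  rw [h1, h4, Pi.add_apply, h2, h3, convF_congr .rfl (Lp.coeFn_add g h)]
  simp only [convF, Pi.add_apply, mul_add]
  exact integral_add h5 h6

theorem smul_conv (c : ℂ) (f g : L1 n) : conv (c • f) g = c • conv f g := by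
  refine Lp.ext ?_
  filter_upwards [conv_coeFn (c • f) g, conv_coeFn f g, Lp.coeFn_smul c (conv f g)] with p h1 h2 h3
  rw [h1, h3, Pi.smul_apply, h2, convF_congr (Lp.coeFn_smul c f) .rfl]
  simp only [convF, Pi.smul_apply, smul_eq_mul, mul_assoc]
  exact integral_const_mul _ _

theorem conv_smul (c : ℂ) (f g : L1 n) : conv f (c • g) = c • conv f g := by
  refine Lp.ext ?_
  filter_upwards [conv_coeFn f (c • g), conv_coeFn f g, Lp.coeFn_smul c (conv f g)] with p h1 h2 h3
  rw [h1, h3, Pi.smul_apply, h2, convF_congr .rfl (Lp.coeFn_smul c g)]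
  simp only [convF, Pi.smul_apply, smul_eq_mul, mul_left_comm _ c]
  exact integral_const_mul _ _


instance : SFinite ((volume : Measure (H n)).prod (volume : Measure (H n))) :=
  Measure.prod.instSFinite

theorem measurePreserving_mul_inv_fst : MeasurePreserving
    (fun z : H n × (H n × H n) => (mul z.1 (inv z.2.1), z.2))
      (volume.prod (volume.prod volume)) (volume.prod (volume.prod volume)) := by
  have h1 : MeasurePreserving (fun z : (H n × H n) × H n => (z.1, mul z.2 (inv z.1.1)))
      ((volume.prod volume).prod volume) ((volume.prod volume).prod volume) := by
    refine MeasurePreserving.skew_product (f := fun w : H n × H n => w)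
      (g := fun (w : H n × H n) (p : H n) => mul p (inv w.1)) (MeasurePreserving.id _) ?_
      (.of_forall fun w => (measurePreserving_mul_right (inv w.1)).map_eq)
    exact (continuous_mul_inv.comp
      (continuous_snd.prodMk (continuous_fst.comp continuous_fst))).measurable
  exact (Measure.measurePreserving_swap.comp h1).comp Measure.measurePreserving_swap

theorem convF_assoc {f g h : H n → ℂ} (hf : Integrable f) (hg : Integrable g) (hh : Integrable h) :
    convF (convF f g) h =ᵐ[volume] convF f (convF g h) := by
  have hi : Integrable (fun z : H n × (H n × H n) => f (mul z.1 (inv z.2.1)) *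
      (g (mul z.2.1 (inv z.2.2)) * h z.2.2)) (volume.prod (volume.prod volume)) :=
    measurePreserving_mul_inv_fst.integrable_comp_of_integrable
      (hf.mul_prod (integrable_mul_inv_prod hg hh))
  filter_upwards [hi.prod_right_ae] with p hp
  calc convF (convF f g) h p
      = ∫ q, ∫ r, f (mul p (inv r)) * (g (mul r (inv q)) * h q) := by
        refine integral_congr_ae (.of_forall fun q => ?_)
        simp only [← mul_assoc]
        rw [integral_mul_const, convF, ← integral_comp_mul_right _ (inv q)]
        simp only [mul_mul_inv_mul_inv]
    _ = ∫ r, ∫ q, f (mul p (inv r)) * (g (mul r (inv q)) * h q) :=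
        (integral_integral_swap hp).symm
    _ = convF f (convF g h) p := by simp only [integral_const_mul]; rfl

theorem conv_assoc (f g h : L1 n) : conv (conv f g) h = conv f (conv g h) := by
  refine Lp.ext ?_
  filter_upwards [conv_coeFn (conv f g) h, conv_coeFn f (conv g h),
    convF_assoc (L1.integrable_coeFn f) (L1.integrable_coeFn g) (L1.integrable_coeFn h)]
    with p h1 h2 h3
  rw [h1, h2, convF_congr (conv_coeFn f g) .rfl,
    convF_congr .rfl (conv_coeFn g h), h3]

theorem convF_comp_fourierAut {lam : ℝ} (hlam : lam ≠ 0) (f g : H n → ℂ) :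
    convF f g ∘ fourierAut lam = convF (f ∘ fourierAut lam) (g ∘ fourierAut lam) := by
  funext p
  rw [Function.comp_apply, convF, ← integral_comp_fourierAut hlam]
  have hinv (q : H n) : inv (fourierAut lam q) = fourierAut lam (inv q) := by
    simp [inv, fourierAut]
  simp only [convF, Function.comp_apply, fourierAut_mul hlam, hinv]

end Convolution

/-! ### Kernels of sums and convolutions -/

section KernelConvolution

variable {n : ℕ} {lam : ℝ}

/-- The factor `e^{i lam (t + m·x)}` at `w = (x, t)` against which `f(·, u, ·)` is integrated in
`kern lam f m u`. -/
def phase (lam : ℝ) (m : E n) (w : E n × ℝ) : ℂ :=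
  Complex.exp (Complex.I * ((lam * (w.2 + inner ℝ m w.1) : ℝ) : ℂ))

theorem continuous_phase (lam : ℝ) (m : E n) : Continuous (phase lam m) := by
  unfold phase; fun_prop

theorem norm_phase (m : E n) (w : E n × ℝ) : ‖phase lam m w‖ = 1 :=
  Complex.norm_exp_I_mul_ofReal _

theorem integrable_mul_phase {α : Type*} [MeasurableSpace α] {μ : Measure α} {f : α → ℂ}
    (hf : Integrable f μ) {w : α → E n × ℝ} (hw : Measurable w) (m : E n) :
    Integrable (fun a => f a * phase lam m (w a)) μ :=
  hf.mul_bdd ((continuous_phase lam m).measurable.comp hw).aestronglyMeasurable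
    (.of_forall fun a => (norm_phase m (w a)).le)

theorem kern_eq_integral_integral (f : H n → ℂ) (m u : E n) :
    kern lam f m u = ∫ x, ∫ t, f (x, u, t) * phase lam m (x, t) := by
  simp only [kern, centralFourier, ← integral_mul_const, mul_assoc, ← Complex.exp_add, phase]
  congr! 6
  push_cast
  ring

theorem kern_eq_integral_prod {f : H n → ℂ} {u : E n}
    (h : Integrable fun w : E n × ℝ => f (w.1, u, w.2)) (m : E n) :
    kern lam f m u = ∫ w : E n × ℝ, f (w.1, u, w.2) * phase lam m w := by
  rw [kern_eq_integral_integral]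
  exact (integral_prod _ (integrable_mul_phase h measurable_id m)).symm

theorem kern_add {f g : H n → ℂ} (hf : Integrable f) (hg : Integrable g) :
    ∀ᵐ u, ∀ m, kern lam (f + g) m u = kern lam f m u + kern lam g m u := by
  filter_upwards [ae_integrable_slice hf, ae_integrable_slice hg] with u h1 h2 m
  rw [kern_eq_integral_prod h1, kern_eq_integral_prod h2, kern_eq_integral_prod (h1.add h2)]
  simp only [Pi.add_apply, add_mul]
  exact integral_add (integrable_mul_phase h1 measurable_id m)
    (integrable_mul_phase h2 measurable_id m)

theorem kern_smul (c : ℂ) (f : H n → ℂ) (m u : E n) :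
    kern lam (c • f) m u = c * kern lam f m u := by
  simp only [kern_eq_integral_integral, Pi.smul_apply, smul_eq_mul, mul_assoc, integral_const_mul]



theorem KernDecay.add {f g : H n → ℂ} (hf : Integrable f) (hg : Integrable g)
    (kf : KernDecay lam f) (kg : KernDecay lam g) : KernDecay lam (f + g) :=
  (AEExpDecay.add (fun _ => by positivity) kf kg).congr
    ((Measure.quasiMeasurePreserving_snd.ae (kern_add hf hg)).mono fun z hz => (hz z.1).symm)

theorem KernDecay.smul (c : ℂ) {f : H n → ℂ} (kf : KernDecay lam f) :
    KernDecay lam (c • f) := by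
  simpa only [KernDecay, kern_smul] using AEExpDecay.const_mul kf c

theorem KernDecay.zero : KernDecay lam (0 : H n → ℂ) :=
  ⟨1, one_pos, 0, .of_forall fun z => by simp [kern, centralFourier]⟩

theorem ae_integrable_slice_mul_inv {f g : H n → ℂ} (hf : Integrable f) (hg : Integrable g) :
    ∀ᵐ w : E n, Integrable (fun z : (E n × ℝ) × H n =>
      f (mul (z.1.1, w, z.1.2) (inv z.2)) * g z.2) (volume.prod volume) := by
  have h1 : MeasurePreserving (MeasurableEquiv.prodAssoc : H n × H n ≃ᵐ E n × ((E n × ℝ) × H n)) :=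
    volume_preserving_prodAssoc
  have h2 : MeasurePreserving (Prod.map (swapVar : H n ≃ᵐ H n) (id : H n → H n))
      (volume.prod volume) (volume.prod volume) :=
    measurePreserving_swapVar.prod (MeasurePreserving.id volume)
  have h3 := (h2.comp (h1.symm MeasurableEquiv.prodAssoc)).integrable_comp_of_integrable
    (integrable_mul_inv_prod hf hg)
  exact Integrable.prod_right_ae (ν := volume.prod volume) h3

theorem measurePreserving_shear_real (y v : E n) (c : ℝ) :
    MeasurePreserving fun z : E n × ℝ => (z.1 + y, z.2 + (c - 1 / 2 * inner ℝ v (z.1 + y))) :=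
  MeasurePreserving.skew_product (f := fun x : E n => x + y)
    (g := fun (x : E n) (t : ℝ) => t + (c - 1 / 2 * inner ℝ v (x + y)))
    (measurePreserving_add_right volume y) (Continuous.measurable (by fun_prop))
    (.of_forall fun _ => (measurePreserving_add_right volume _).map_eq)

theorem measurableEmbedding_shear_real (y v : E n) (c : ℝ) : MeasurableEmbedding
    fun z : E n × ℝ => (z.1 + y, z.2 + (c - 1 / 2 * inner ℝ v (z.1 + y))) := by
  refine Continuous.measurableEmbedding (by fun_prop) fun a b h => ?_
  simp only [Prod.mk.injEq] at h
  have e : a.1 = b.1 := add_right_cancel h.1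
  refine Prod.ext e ?_
  have h2 := h.2
  rw [e] at h2
  exact add_right_cancel h2

theorem integral_slice_mul_inv (f g : H n → ℂ) (m w : E n) (q : H n) :
    ∫ z : E n × ℝ, f (mul (z.1, w, z.2) (inv q)) * g q * phase lam m z =
      (∫ z : E n × ℝ, f (z.1, w - q.2.1, z.2) * phase lam (m - (1 / 2 : ℝ) • q.2.1) z) *
        (g q * phase lam (m + (1 / 2 : ℝ) • (w - q.2.1)) (q.1, q.2.2)) := by
  rw [← (measurePreserving_shear_real q.1 q.2.1 (q.2.2 + 1 / 2 * inner ℝ w q.1)).integral_comp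
    (measurableEmbedding_shear_real _ _ _), ← integral_mul_const]
  refine integral_congr_ae (.of_forall fun z => ?_)
  have harg : mul (z.1 + q.1, w, z.2 + (q.2.2 + 1 / 2 * inner ℝ w q.1 -
      1 / 2 * inner ℝ q.2.1 (z.1 + q.1))) (inv q) = (z.1, w - q.2.1, z.2) := by
    ext : 2
    · simp [mul, inv]
    · simp [mul, inv, sub_eq_add_neg]
    · simp only [mul, inv, inner_neg_left, inner_neg_right]
      ring
  simp only [harg, phase]
  rw [mul_mul_mul_comm, ← Complex.exp_add]
  congr 2
  simp only [inner_add_left, inner_add_right, inner_sub_left, real_inner_smul_left]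
  push_cast
  ring

theorem ae_integral_slice_mul_inv {f : H n → ℂ} (hf : Integrable f) (g : H n → ℂ) (m w : E n) :
    ∀ᵐ q : H n, ∫ z : E n × ℝ, f (mul (z.1, w, z.2) (inv q)) * g q * phase lam m z =
      kern lam f (m - (1 / 2 : ℝ) • q.2.1) (w - q.2.1) *
        (g q * phase lam (m + (1 / 2 : ℝ) • (w - q.2.1)) (q.1, q.2.2)) := by
  have h1 : ∀ᵐ v : E n, Integrable fun z : E n × ℝ => f (z.1, w - v, z.2) :=
    (Measure.measurePreserving_sub_left volume w).quasiMeasurePreserving.ae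
      (ae_integrable_slice hf)
  have h2 : ∀ᵐ q : H n, Integrable fun z : E n × ℝ => f (z.1, w - q.2.1, z.2) :=
    Measure.quasiMeasurePreserving_snd.ae (Measure.quasiMeasurePreserving_fst.ae h1)
  filter_upwards [h2] with q hq
  rw [integral_slice_mul_inv, kern_eq_integral_prod hq]

/-- In terms of the operator kernels `(ξ, η) ↦ kern lam f ((ξ + η) / 2) (η - ξ)`, this is the
composition rule `∫ K_f(ξ, ζ) K_g(ζ, η) dζ` with `m = (ξ + η) / 2`, `w = η - ξ`, `v = η - ζ`. -/
theorem kern_convF {f g : H n → ℂ} (hf : Integrable f) (hg : Integrable g) :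
    ∀ᵐ w, ∀ m, kern lam (convF f g) m w = ∫ v, kern lam f (m - (1 / 2 : ℝ) • v) (w - v) *
      kern lam g (m + (1 / 2 : ℝ) • (w - v)) v := by
  filter_upwards [ae_integrable_slice_mul_inv hf hg] with w hw m
  have hint : Integrable (fun z : (E n × ℝ) × H n =>
      f (mul (z.1.1, w, z.1.2) (inv z.2)) * g z.2 * phase lam m z.1) (volume.prod volume) :=
    integrable_mul_phase hw measurable_fst m
  have hslice := ae_integral_slice_mul_inv (lam := lam) hf g m w
  calc kern lam (convF f g) m w
      = ∫ x, ∫ t, ∫ q, f (mul (x, w, t) (inv q)) * g q * phase lam m (x, t) := by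
        simp only [kern_eq_integral_integral, convF, integral_mul_const]
    _ = ∫ z : E n × ℝ, ∫ q, f (mul (z.1, w, z.2) (inv q)) * g q * phase lam m z :=
        (integral_prod _ hint.integral_prod_left).symm
    _ = ∫ q, ∫ z : E n × ℝ, f (mul (z.1, w, z.2) (inv q)) * g q * phase lam m z :=
        integral_integral_swap hint
    _ = ∫ q : H n, kern lam f (m - (1 / 2 : ℝ) • q.2.1) (w - q.2.1) *
          (g q * phase lam (m + (1 / 2 : ℝ) • (w - q.2.1)) (q.1, q.2.2)) :=
        integral_congr_ae hslice
    _ = _ := by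
        rw [integral_iterated (hint.integral_prod_right.congr hslice)]
        simp only [integral_const_mul, kern_eq_integral_integral]

theorem ae_ae_shear {P : E n × E n → Prop} (h : ∀ᵐ z, P z) (c : ℝ) :
    ∀ᵐ z : E n × E n, ∀ᵐ v, P (z.1 + c • (z.2 - v), v) := by
  have h1 := Measure.ae_ae_of_ae_prod ((measurePreserving_shear (-c)).quasiMeasurePreserving.ae h)
  have h2 : Measure.QuasiMeasurePreserving fun z : E n × E n => z.1 + c • z.2 :=
    Measure.quasiMeasurePreserving_fst.comp (measurePreserving_shear c).quasiMeasurePreserving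
  filter_upwards [h2.ae h1] with z hz
  filter_upwards [hz] with v hv
  rwa [smul_sub, add_sub_assoc', sub_eq_add_neg, ← neg_smul]

theorem half_norm_add_norm_add_le (m w v : E n) : 1 / 2 * (‖m‖ + ‖w‖) + 1 / 4 * ‖v‖ ≤
    ‖m - (1 / 2 : ℝ) • v‖ + ‖w - v‖ + (‖m + (1 / 2 : ℝ) • (w - v)‖ + ‖v‖) := by
  have hw : ‖w‖ ≤ ‖w - v‖ + ‖v‖ := norm_le_norm_sub_add w v
  have hm : ‖m‖ ≤ ‖m - (1 / 2 : ℝ) • v‖ + 1 / 2 * ‖v‖ := by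
    simpa [norm_smul] using norm_le_norm_sub_add m ((1 / 2 : ℝ) • v)
  linarith [norm_nonneg (m - (1 / 2 : ℝ) • v), norm_nonneg (w - v),
    norm_nonneg (m + (1 / 2 : ℝ) • (w - v))]

theorem KernDecay.conv {f g : H n → ℂ} (hf : Integrable f) (hg : Integrable g)
    (kf : KernDecay lam f) (kg : KernDecay lam g) : KernDecay lam (convF f g) := by
  obtain ⟨t, ht, C, hF, hG⟩ :=
    AEExpDecay.exists_common (fun _ => by positivity) (fun _ => by positivity) kf kg
  set M := ∫ v : E n, Real.exp (-(t / 4) * ‖v‖)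
  have hM : Integrable fun v : E n => Real.exp (-(t / 4) * ‖v‖) :=
    integrable_exp_neg_mul_norm (by positivity)
  refine ⟨t / 2, half_pos ht, C * C * M, ?_⟩
  filter_upwards [ae_ae_shear hF (-(1 / 2)), ae_ae_shear hG (1 / 2),
    Measure.quasiMeasurePreserving_snd.ae (kern_convF (lam := lam) hf hg)] with ⟨m, w⟩ h1 h2 h3
  have hbound : ∀ᵐ v, ‖kern lam f (m - (1 / 2 : ℝ) • v) (w - v) *
      kern lam g (m + (1 / 2 : ℝ) • (w - v)) v‖ ≤
        C * C * Real.exp (-(t / 2) * (‖m‖ + ‖w‖)) * Real.exp (-(t / 4) * ‖v‖) := by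
    filter_upwards [(Measure.measurePreserving_sub_left volume w).quasiMeasurePreserving.ae h1, h2]
      with v hv1 hv2
    rw [sub_sub_cancel, neg_smul, ← sub_eq_add_neg] at hv1
    rw [norm_mul, mul_assoc (C * C), ← Real.exp_add]
    calc _ ≤ _ := mul_le_mul hv1 hv2 (norm_nonneg _) ((norm_nonneg _).trans hv1)
      _ = C * C * Real.exp (-t * (‖m - (1 / 2 : ℝ) • v‖ + ‖w - v‖ +
          (‖m + (1 / 2 : ℝ) • (w - v)‖ + ‖v‖))) := by
        rw [mul_mul_mul_comm, ← Real.exp_add, ← mul_add]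
      _ ≤ _ := by
        refine mul_le_mul_of_nonneg_left (Real.exp_le_exp.2 ?_) (mul_self_nonneg C)
        linarith [mul_le_mul_of_nonneg_left (half_norm_add_norm_add_le m w v) ht.le]
  calc _ ≤ ∫ v, C * C * Real.exp (-(t / 2) * (‖m‖ + ‖w‖)) * Real.exp (-(t / 4) * ‖v‖) :=
        (congrArg norm (h3 m)).trans_le (norm_integral_le_of_norm_le (hM.const_mul _) hbound)
    _ = _ := by rw [integral_const_mul, mul_right_comm]

theorem integrable_comp_fourierAut (hlam : lam ≠ 0) (f : L1 n) :
    Integrable ((f : H n → ℂ) ∘ fourierAut lam) :=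
  (measurePreserving_fourierAut hlam).integrable_comp_of_integrable (L1.integrable_coeFn f)

theorem mem_B_of_ae_eq (hlam : lam ≠ 0) {f : L1 n} {F : H n → ℂ} (h : f =ᵐ[volume] F)
    (h1 : KernDecay lam F) (h2 : KernDecay lam (F ∘ fourierAut lam)) : f ∈ B n lam :=
  (mem_B_iff hlam f).2 ⟨h1.congr h.symm,
    h2.congr ((measurePreserving_fourierAut hlam).quasiMeasurePreserving.ae_eq_comp h).symm⟩

theorem zero_mem_B (hlam : lam ≠ 0) : (0 : L1 n) ∈ B n lam :=
  mem_B_of_ae_eq hlam (Lp.coeFn_zero _ _ _) KernDecay.zero KernDecay.zero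

theorem add_mem_B (hlam : lam ≠ 0) {f g : L1 n} (hf : f ∈ B n lam) (hg : g ∈ B n lam) :
    f + g ∈ B n lam := by
  obtain ⟨f1, f2⟩ := (mem_B_iff hlam f).1 hf
  obtain ⟨g1, g2⟩ := (mem_B_iff hlam g).1 hg
  exact mem_B_of_ae_eq hlam (Lp.coeFn_add f g)
    (KernDecay.add (L1.integrable_coeFn f) (L1.integrable_coeFn g) f1 g1)
    (KernDecay.add (integrable_comp_fourierAut hlam f) (integrable_comp_fourierAut hlam g) f2 g2)

theorem smul_mem_B (hlam : lam ≠ 0) (c : ℂ) {f : L1 n} (hf : f ∈ B n lam) : c • f ∈ B n lam := by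
  obtain ⟨f1, f2⟩ := (mem_B_iff hlam f).1 hf
  exact mem_B_of_ae_eq hlam (Lp.coeFn_smul c f) (f1.smul c) (f2.smul c)

theorem conv_mem_B (hlam : lam ≠ 0) {f g : L1 n} (hf : f ∈ B n lam) (hg : g ∈ B n lam) :
    conv f g ∈ B n lam := by
  obtain ⟨f1, f2⟩ := (mem_B_iff hlam f).1 hf
  obtain ⟨g1, g2⟩ := (mem_B_iff hlam g).1 hg
  refine mem_B_of_ae_eq hlam (conv_coeFn f g)
    (KernDecay.conv (L1.integrable_coeFn f) (L1.integrable_coeFn g) f1 g1) ?_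
  rw [convF_comp_fourierAut hlam]
  exact KernDecay.conv (integrable_comp_fourierAut hlam f) (integrable_comp_fourierAut hlam g) f2 g2

theorem isConvolutionAlgebra_B (hlam : lam ≠ 0) : IsConvolutionAlgebra (B n lam) :=
  ⟨zero_mem_B hlam, fun _ hf _ hg => add_mem_B hlam hf hg, fun c _ hf => smul_mem_B hlam c hf,
    fun _ hf _ hg => conv_mem_B hlam hf hg, fun f _ g _ h _ => conv_assoc f g h,
    fun f _ g _ h _ => add_conv f g h, fun f _ g _ h _ => conv_add f g h,
    fun c f _ g _ => smul_conv c f g, fun c f _ g _ => conv_smul c f g⟩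

end KernelConvolution

end HeisenbergGroup

end

theorem theorem1p1 (n : ℕ) (lam : ℝ) (hlam : lam ≠ 0) :
    HeisenbergGroup.IsConvolutionAlgebra (HeisenbergGroup.B n lam) ∧
    {ψ : HeisenbergGroup.V n | ∃ f ∈ HeisenbergGroup.B n lam, ∃ φ : HeisenbergGroup.V n,
        ψ = HeisenbergGroup.schrodingerInt lam f φ} =
      HeisenbergGroup.analyticVectors n lam :=
  ⟨HeisenbergGroup.isConvolutionAlgebra_B hlam,
    HeisenbergGroup.range_schrodingerInt_eq_analyticVectors hlam⟩
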